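/- Let $k=2s+1\ge 3$ be odd, let $a_1,a_2,a_3\in\mathbb C$ be pairwise distinct and let $c\in\mathbb C\setminus\{a_1,a_2,a_3\}$. Indices $(\alpha,\beta,\gamma)$ run over the cyclic permutations of $(1,2,3)$. Put $a=\mathrm{diag}(a_1,a_2,a_3)$, $b_\alpha=ka_\alpha$, $a_{ij}=a_i-a_j$, and $$A_n=\begin{pmatrix}-n\,a_{32}&b_3&-b_2\\-b_3&-n\,a_{13}&b_1\\b_2&-b_1&-n\,a_{21}\end{pmatrix},\qquad P(M)=\mathrm{diag}(M_1,M_2,M_3)\,(A_1^{-1}K)(A_3^{-1}K)\cdots(A_{k-2}^{-1}K)\,T,$$ where $K=\mathrm{diag}(M_1^2,M_2^2,M_3^2)$ and $T\ne0$ spans $\ker A_k$. Let $U_4(\lambda)=-(\lambda-a_1)(\lambda-a_2)(\lambda-a_3)(\lambda-c)$, let $\mathcal E$ be the compactification of $\mu^2=U_4(\lambda)$ (with two points at infinity), and let $\kappa_\alpha=\frac{(a_\beta-c)(a_\gamma-c)}{(a_\alpha-a_\beta)(a_\alpha-a_\gamma)}$. Let $F_{s,\alpha}(\lambda)$ (a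 polynomial of degree at most $s$) be the $\alpha$-th component of $(A_1^{-1}K)(A_3^{-1}K)\cdots(A_{k-2}^{-1}K)T$ with $K$ replaced by $\mathrm{diag}(\kappa_i(\lambda-a_i))$, and let $$Q_{k,\alpha}(\lambda)=(a_\gamma-c)(a_\alpha-a_\gamma)(\lambda-a_\beta)F_{s,\beta}^2(\lambda)+(a_\beta-c)(a_\beta-a_\alpha)(\lambda-a_\gamma)F_{s,\gamma}^2(\lambda).$$ Then: (0) There is a constant $\Delta_k$ with $\sum_\alpha\kappa_\alpha(\lambda-a_\alpha)F_{s,\alpha}^2(\lambda)=\Delta_k(\lambda-c)^k$. If the $a_i$ and $c$ are real and $\min_i a_i<c<\max_i a_i$ (as for real motions), then $\Delta_k\neq0$. Moreover $Q_{k,\alpha}(c)\ne0$ for every $\alpha$. Moreover there are polynomials $q_{s+1,\alpha}$ ($\alpha=1,2,3$) of degree at most $s+1$ such that the differentials $$W_\alpha=\frac{q_{s+1,\alpha}(\lambda)(\lambda-c)^s}{Q_{k,\alpha}(\lambda)}\,\frac{d\lambda}{\mu}$$ on $\mathcal E$ have the following properties. (1) Suppose $\Delta_k\ne0$ and let $m\in\mathbb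 C\setminus\{0\}$. Let $M$ be a holomorphic solution of the Euler equations $\dot M=M\times aM$ on a simply connected domain $D\subset\mathbb C$ of complex time, with $\langle M,M\rangle=m^2$ and $\langle M,aM\rangle=c\,m^2$. Then $P(M(t))$ solves the Poisson equations $\dot\gamma=k\,\gamma\times aM(t)$ on $D$, and these equations have two further solutions $G^{(1)},G^{(2)}$ on $D$ such that $P(M(t)),G^{(1)}(t),G^{(2)}(t)$ are linearly independent for every $t\in D$. Let $V\subset D$ be open and let $\lambda,\mu$ be functions on $V$ with $\lambda\ne c$, $$M_\alpha^2=m^2\kappa_\alpha\frac{\lambda-a_\alpha}{\lambda-c}\quad(\alpha=1,2,3),\qquad \dot\lambda=2m\mu,\qquad \mu^2=U_4(\lambda).$$ Then on $V$ one has $Q_{k,\alpha}(\lambda)=\mathrm{const}\cdot(P_\beta^2+P_\gamma^2)(\lambda-c)^k$ with a nonzero constant depending only on $\alpha$, $m$ and the data $k,a,c,T$. For each $\alpha$ such that $V$ is simply connected and $Q_{k,\alpha}(\lambda)$ does not vanish on $V$, there are on $V$ a continuous branch of $\sqrt{Q_{k,\alpha}(\lambda)/(\lambda-c)^k}$ and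 a holomorphic branch of $\int W_\alpha$, and nonzero constants $c_{1,\alpha},c_{2,\alpha}$, with $$G^{(1)}_\alpha=c_{1,\alpha}\frac{\sqrt{Q_{k,\alpha}(\lambda)}}{\sqrt{(\lambda-c)^k}}\exp\Bigl(\tfrac12\int W_\alpha\Bigr),\qquad G^{(2)}_\alpha=c_{2,\alpha}\frac{\sqrt{Q_{k,\alpha}(\lambda)}}{\sqrt{(\lambda-c)^k}}\exp\Bigl(-\tfrac12\int W_\alpha\Bigr).$$ (2) Let $\alpha$ be such that $Q_{k,\alpha}(\lambda)=r_{0,\alpha}\prod_{i=1}^k(\lambda-r_{i,\alpha})$ with $r_{0,\alpha}\ne0$ and with $r_{1,\alpha},\dots,r_{k,\alpha}$ pairwise distinct and different from $a_1,a_2,a_3$. Then, for a suitable choice of the signs of the (nonzero) square roots, $W_\alpha$ has simple poles with residues $\pm1$ at the points $\mathcal P^\pm_{i,\alpha}=(r_{i,\alpha},\pm\sqrt{U_4(r_{i,\alpha})})$, $i=1,\dots,k$, and is holomorphic at all other points of $\mathcal E$, including the infinite ones. Moreover $q_{s+1,\alpha}$ is the only polynomial of degree at most $s+1$ for which $W_\alpha$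 has simple poles with these residues at these points. -/

import Mathlib

open Polynomial Filter Topology
open scoped Matrix

noncomputable section

namespace EulerPoisson

/-! ### The Euler equations, the generalized Poisson equations and the solution `P` -/

/-- `M` solves the Euler equations `M' = M × aM` (complex time) on the set `D`. -/
def IsEulerSolution (a : Fin 3 → ℂ) (D : Set ℂ) (M : ℂ → Fin 3 → ℂ) : Prop :=
  ∀ t ∈ D, HasDerivAt M (M t ⨯₃ (a * M t)) t

/-- `g` solves the generalized Poisson equations `g' = k g × aM` on the set `D`. -/
def IsPoissonSolution (a : Fin 3 → ℂ) (k : ℕ) (M : ℂ → Fin 3 → ℂ) (D : Set ℂ)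
    (g : ℂ → Fin 3 → ℂ) : Prop :=
  ∀ t ∈ D, HasDerivAt g ((k : ℂ) • (g t ⨯₃ (a * M t))) t

/-- The matrix `A_n` built from `a` and `b`. -/
def matA (a b : Fin 3 → ℂ) (n : ℕ) : Matrix (Fin 3) (Fin 3) ℂ :=
  !![-n * (a 2 - a 1), b 2, -b 1;
     -b 2, -n * (a 0 - a 2), b 0;
     b 1, -b 0, -n * (a 1 - a 0)]

/-- `P(M) = diag(M) (A_1⁻¹ K) (A_3⁻¹ K) ⋯ (A_{k-2}⁻¹ K) T`, `K = diag(M_1², M_2², M_3²)`,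
where `k = 2 s + 1` and `b = k a`. -/
def vecP (a : Fin 3 → ℂ) (k s : ℕ) (T : Fin 3 → ℂ) (M : Fin 3 → ℂ) : Fin 3 → ℂ :=
  M * (((List.range s).map fun j =>
    (matA a ((k : ℂ) • a) (2 * j + 1))⁻¹ * Matrix.diagonal (M ^ 2)).prod *ᵥ T)

/-! ### The elliptic curve and the parametrization by `λ` -/

/-- `U₄ = -(X - a₁)(X - a₂)(X - a₃)(X - c)`. -/
def polyU (a : Fin 3 → ℂ) (c : ℂ) : ℂ[X] :=
  -((∏ i, (X - C (a i))) * (X - C c))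

/-- `κ_α = (a_β - c)(a_γ - c) / ((a_α - a_β)(a_α - a_γ))`, `(α, β, γ)` cyclic. -/
def kap (a : Fin 3 → ℂ) (c : ℂ) (α : Fin 3) : ℂ :=
  (a (α + 1) - c) * (a (α + 2) - c) / ((a α - a (α + 1)) * (a α - a (α + 2)))

/-- The functions `lam`, `mu` on `V` are the curve parameter attached to `M`:
`M_α² = m² κ_α (λ - a_α)/(λ - c)` and `dλ/dt = 2 m μ`, `μ² = U₄(λ)`. -/
structure IsCurveParam (a : Fin 3 → ℂ) (c m : ℂ) (M : ℂ → Fin 3 → ℂ) (V : Set ℂ)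
    (lam mu : ℂ → ℂ) : Prop where
  ne_c : ∀ t ∈ V, lam t ≠ c
  param : ∀ t ∈ V, ∀ α, M t α ^ 2 = m ^ 2 * kap a c α * ((lam t - a α) / (lam t - c))
  curve : ∀ t ∈ V, mu t ^ 2 = (polyU a c).eval (lam t)
  deriv_eq : ∀ t ∈ V, HasDerivAt lam (2 * m * mu t) t

/-- The polynomials `F_{s,α}`: the components of
`(A_1⁻¹ K) (A_3⁻¹ K) ⋯ (A_{k-2}⁻¹ K) T` after the substitution `M_α² ↦ κ_α (X - a_α)`, that is,
the numerators (with respect to `(λ - c)^s`) of this vector in the parametrization by `λ`. -/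
def polyF (a : Fin 3 → ℂ) (c : ℂ) (k s : ℕ) (T : Fin 3 → ℂ) : Fin 3 → ℂ[X] :=
  ((List.range s).map fun j =>
    ((matA a ((k : ℂ) • a) (2 * j + 1))⁻¹).map C *
      Matrix.diagonal (fun i => C (kap a c i) * (X - C (a i)))).prod *ᵥ (fun i => C (T i))

/-- The numerator of `P_1² + P_2² + P_3²` with respect to `(λ - c)^k`. -/
def polySq (a : Fin 3 → ℂ) (c : ℂ) (k s : ℕ) (T : Fin 3 → ℂ) : ℂ[X] :=
  ∑ α, C (kap a c α) * (X - C (a α)) * polyF a c k s T α ^ 2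

/-- The polynomials `Q_{k,α}`, `(α, β, γ)` cyclic:
`(a_γ - c)(a_α - a_γ)(X - a_β) F_β² + (a_β - c)(a_β - a_α)(X - a_γ) F_γ²`. -/
def polyQ (a : Fin 3 → ℂ) (c : ℂ) (k s : ℕ) (T : Fin 3 → ℂ) (α : Fin 3) : ℂ[X] :=
  C ((a (α + 2) - c) * (a α - a (α + 2))) * (X - C (a (α + 1))) *
      polyF a c k s T (α + 1) ^ 2 +
    C ((a (α + 1) - c) * (a (α + 1) - a α)) * (X - C (a (α + 2))) *
      polyF a c k s T (α + 2) ^ 2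

/-! ### Differentials on the compactified curve `μ² = U₄(λ)` -/

/-- The coefficient `w(λ, μ)` of the differential
`W = w dλ = q(λ) (λ - c)^s / Q(λ) · dλ / μ`. -/
def diffW (c : ℂ) (s : ℕ) (q Q : ℂ[X]) (x y : ℂ) : ℂ :=
  q.eval x * (x - c) ^ s / (Q.eval x * y)

/-- Near `0` (punctured), `f(τ) = ρ/τ + (holomorphic)`: at most a simple pole, residue `ρ`. -/
def SimplePart (f : ℂ → ℂ) (ρ : ℂ) : Prop :=
  ∃ g : ℂ → ℂ, AnalyticAt ℂ g 0 ∧ ∀ᶠ τ in 𝓝[≠] 0, f τ = ρ / τ + g τ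

/-- `τ ↦ (x τ, y τ)` is a local holomorphic parametrization (inverse of a local coordinate,
with the point at `τ = 0`) of the affine curve `μ² = p(λ)` at its point `(x₀, y₀)`. -/
structure IsLocalParam (p : ℂ[X]) (x₀ y₀ : ℂ) (x y : ℂ → ℂ) : Prop where
  analytic_x : AnalyticAt ℂ x 0
  analytic_y : AnalyticAt ℂ y 0
  x_zero : x 0 = x₀
  y_zero : y 0 = y₀
  curve : ∀ᶠ τ in 𝓝 0, y τ ^ 2 = p.eval (x τ)
  immersed : deriv x 0 ≠ 0 ∨ deriv y 0 ≠ 0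

/-- The polynomial `-(1 - a₁ X)(1 - a₂ X)(1 - a₃ X)(1 - c X)`; in the coordinates `ξ = 1/λ`,
`η = μ/λ²` the curve is `η² = V₄(ξ)`, and `∞_±` are its points with `ξ = 0`. -/
def polyV (a : Fin 3 → ℂ) (c : ℂ) : ℂ[X] :=
  -((∏ i, (1 - C (a i) * X)) * (1 - C c * X))

/-- At the point `(x₀, y₀)` of `μ² = U₄(λ)` the differential `w dλ` has the form
`(ρ/τ + holomorphic) dτ` in every local coordinate `τ`. -/
def FinitePart (a : Fin 3 → ℂ) (c : ℂ) (w : ℂ → ℂ → ℂ) (x₀ y₀ ρ : ℂ) : Prop :=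
  ∀ x y : ℂ → ℂ, IsLocalParam (polyU a c) x₀ y₀ x y →
    SimplePart (fun τ => w (x τ) (y τ) * deriv x τ) ρ

/-- At the infinite point `ξ = 0, η = η₀` of the compactified curve the differential `w dλ` has
the form `(ρ/τ + holomorphic) dτ` in every local coordinate `τ`. -/
def InfinitePart (a : Fin 3 → ℂ) (c : ℂ) (w : ℂ → ℂ → ℂ) (η₀ ρ : ℂ) : Prop :=
  ∀ ξ η : ℂ → ℂ, IsLocalParam (polyV a c) 0 η₀ ξ η →
    SimplePart (fun τ => w (ξ τ)⁻¹ (η τ / ξ τ ^ 2) * deriv (fun σ => (ξ σ)⁻¹) τ) ρ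

end EulerPoisson

end

open EulerPoisson

/-! Write `d_α = a_γ - a_β`. The Euler equations read `M_α' = d_α M_β M_γ`, so `K = M ^ 2` moves
with `K' = 2 π d`, where `π = M_1 M_2 M_3`. Put `H_0 = T` and `H_{n+1} = A_{k-2n-2}⁻¹ K H_n`. Since
`A_{n-2} = A_n + 2 diag(d)` and `A_k T = 0`, induction gives `H_{n+1}' = π H_n`
(`hasDerivAt_vecH_succ`). With `A_1 H_s = K H_{s-1}` this is exactly the Poisson equation for `P = M
H_s`.

The computation only uses that `K` moves in the direction `d`, so `∑ K_i H_i ^ 2` is constant on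
every line with that direction. In particular this holds on the line `λ ↦ κ (λ - a) / (λ - c)`,
whose points satisfy `∑ K_i = 1` and `∑ a_i K_i = c`. Clearing denominators gives `Δ (λ - c) ^ k`
and, by homogeneity, `⟨P, P⟩ = m ^ (2k) Δ`. For real motions the line contains a point with positive
coordinates, where the sum is `T_0 ^ 2` times a sum of real squares with positive weights. At `λ =
c` the vector `K` is proportional to `d`, and `A_n (1,1,1) = (k - n) d` makes all `F_α(c)` equal and
nonzero.

If `Δ ≠ 0`, normalize `P` to a unit solution `e` and complete it to an orthonormal frame of
solutions with `X × Y = e`. The isotropic solutions `G = X ± i Y` satisfy `G¹_α G²_α = 1 - e_α ^ 2 =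
e_β ^ 2 + e_γ ^ 2`, which is `Q_α / (λ - c) ^ k` up to a constant. Also `G¹ × G² = -2 i e`, which
makes the Wronskian of `G¹_α, G²_α` a multiple of `a_β M_β P_β + a_γ M_γ P_γ`. Hence `d log (G¹_α /
G²_α)` is a rational differential: this is `W_α`, and the numerator of the Wronskian is the
polynomial `polyq`. Half the sum and half the difference of the logarithms give the two formulas.

At a root of `Q_α` other than `c`, the relation `K_β H_β ^ 2 + K_γ H_γ ^ 2 = 0` turns the squared
numerator of `W_α` into `Q' ^ 2 U_4` (`sq_residue`), which forces residues `±1` at simple roots with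
`U_4 ≠ 0`. The degree bounds make `W_α` regular at infinity, and the values at `k = 2 s + 1` roots
determine a polynomial of degree at most `s + 1`. -/

noncomputable section

namespace EulerPoisson

/-! ### Holomorphic linear differential equations on simply connected domains -/

section LinearODE

variable {𝔸 : Type*} [NormedRing 𝔸] [NormedAlgebra ℂ 𝔸]

/-- The Taylor coefficients of the solution of `Y' = A Y`, `Y(0) = 1`, where `A = ∑ aₙ zⁿ`. -/
def odeCoeff (a : ℕ → 𝔸) : ℕ → 𝔸
  | 0 => 1
  | n + 1 => ((n : ℂ) + 1)⁻¹ • ∑ j : Fin (n + 1), a j * odeCoeff a (n - j)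

lemma odeCoeff_succ (a : ℕ → 𝔸) (n : ℕ) :
    ((n : ℂ) + 1) • odeCoeff a (n + 1) =
      ∑ j ∈ Finset.range (n + 1), a j * odeCoeff a (n - j) := by
  rw [odeCoeff, smul_smul, mul_inv_cancel₀ (Nat.cast_add_one_ne_zero n), one_smul,
    Fin.sum_univ_eq_sum_range (fun j => a j * odeCoeff a (n - j))]

/-- In the recursion the division by `n + 1` cancels the number of summands, each at most `B ‖1‖ (B
+ ρ) ^ n`. The factor `‖1‖` is kept because the norm of the unit is not assumed to be 1. -/
lemma norm_odeCoeff_le {a : ℕ → 𝔸} {B ρ : ℝ} (hB : 0 ≤ B) (hρ : 0 ≤ ρ)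
    (ha : ∀ n, ‖a n‖ ≤ B * ρ ^ n) (n : ℕ) :
    ‖odeCoeff a n‖ ≤ ‖(1 : 𝔸)‖ * (B + ρ) ^ n := by
  induction n using Nat.strong_induction_on with
  | _ n ih =>
    rcases n with _ | n
    · simp [odeCoeff]
    · have hpos : (0 : ℝ) < n + 1 := by positivity
      have h1 : ‖((n : ℂ) + 1) • odeCoeff a (n + 1)‖ = (n + 1) * ‖odeCoeff a (n + 1)‖ := by
        rw [norm_smul]
        congr 1
        have : ((n : ℂ) + 1) = ((n + 1 : ℝ) : ℂ) := by push_cast; rfl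
        rw [this, Complex.norm_real, Real.norm_of_nonneg hpos.le]
      rw [odeCoeff_succ] at h1
      have h2 : ∀ j ∈ Finset.range (n + 1), ‖a j * odeCoeff a (n - j)‖ ≤
          B * (‖(1 : 𝔸)‖ * (B + ρ) ^ n) := by
        intro j hj
        have hj' : j ≤ n := by simpa [Nat.lt_succ_iff] using hj
        calc ‖a j * odeCoeff a (n - j)‖ ≤ ‖a j‖ * ‖odeCoeff a (n - j)‖ := norm_mul_le _ _
          _ ≤ (B * (B + ρ) ^ j) * (‖(1 : 𝔸)‖ * (B + ρ) ^ (n - j)) := by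
            gcongr
            · exact (ha j).trans (by gcongr; linarith)
            · exact ih _ (by omega)
          _ = B * (‖(1 : 𝔸)‖ * ((B + ρ) ^ j * (B + ρ) ^ (n - j))) := by ring
          _ = _ := by rw [← pow_add, Nat.add_sub_cancel' hj']
      have h3 := (norm_sum_le _ _).trans (Finset.sum_le_sum h2)
      rw [h1, Finset.sum_const, Finset.card_range, nsmul_eq_mul] at h3
      push_cast at h3
      have h4 : ‖odeCoeff a (n + 1)‖ ≤ B * (‖(1 : 𝔸)‖ * (B + ρ) ^ n) := le_of_mul_le_mul_left h3 hpos
      refine h4.trans ?_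
      have : 0 ≤ ‖(1 : 𝔸)‖ * (B + ρ) ^ n := by positivity
      rw [pow_succ]
      nlinarith

variable [CompleteSpace 𝔸]

lemma exists_local_fundamental {A : ℂ → 𝔸} {t₀ : ℂ} (hA : AnalyticAt ℂ A t₀) :
    ∃ r > 0, ∃ Φ : ℂ → 𝔸, Φ t₀ = 1 ∧
      ∀ t ∈ Metric.ball t₀ r, HasDerivAt Φ (A t * Φ t) t ∧ IsUnit (Φ t) := by
  obtain ⟨p, hp⟩ := hA
  obtain ⟨B, ρ, hB, hρ, hbd⟩ := p.le_mul_pow_of_radius_pos hp.radius_pos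
  obtain ⟨r₁, hr₁, hsum⟩ := Metric.eventually_nhds_iff.1 (hasFPowerSeriesAt_iff.1 hp)
  set a : ℕ → 𝔸 := p.coeff
  have ha : ∀ n, ‖a n‖ ≤ B * ρ ^ n := fun n => by
    rw [← FormalMultilinearSeries.norm_apply_eq_norm_coef]; exact hbd n
  set L := B + ρ
  have hL : 0 < L := by positivity
  set Y := odeCoeff a
  have hY : ∀ n, ‖Y n‖ ≤ ‖(1 : 𝔸)‖ * L ^ n := norm_odeCoeff_le hB.le hρ.le ha
  -- The bound `1 / (2 L)` makes both series dominated by geometric series of ratio `1 / 2`, also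
  -- after termwise differentiation.
  set r₂ := min r₁ (1 / (2 * L))
  have hr₂ : 0 < r₂ := by positivity
  have hzL : ∀ z : ℂ, z ∈ Metric.ball (0 : ℂ) r₂ → ‖z‖ * L ≤ 1 / 2 := by
    intro z hz
    have : ‖z‖ ≤ 1 / (2 * L) := by
      have := (mem_ball_zero_iff.1 hz).le.trans (min_le_right _ _)
      exact this
    calc ‖z‖ * L ≤ 1 / (2 * L) * L := by gcongr
      _ = 1 / 2 := by field_simp
  have hsY : ∀ z ∈ Metric.ball (0 : ℂ) r₂, Summable fun n => ‖z ^ n • Y n‖ := by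
    intro z hz
    refine Summable.of_nonneg_of_le (fun _ => norm_nonneg _) (fun n => ?_)
      ((summable_geometric_of_lt_one (r := 1 / 2) (by norm_num) (by norm_num)).mul_left ‖(1 : 𝔸)‖)
    calc ‖z ^ n • Y n‖ ≤ ‖z‖ ^ n * (‖(1 : 𝔸)‖ * L ^ n) := by
          rw [norm_smul, norm_pow]; gcongr; exact hY n
      _ = ‖(1 : 𝔸)‖ * (‖z‖ * L) ^ n := by rw [mul_pow]; ring
      _ ≤ _ := by gcongr; exact hzL z hz
  have hsa : ∀ z ∈ Metric.ball (0 : ℂ) r₂, Summable fun n => ‖z ^ n • a n‖ := by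
    intro z hz
    refine Summable.of_nonneg_of_le (fun _ => norm_nonneg _) (fun n => ?_)
      ((summable_geometric_of_lt_one (r := 1 / 2) (by norm_num) (by norm_num)).mul_left B)
    calc ‖z ^ n • a n‖ ≤ ‖z‖ ^ n * (B * L ^ n) := by
          rw [norm_smul, norm_pow]; gcongr
          exact (ha n).trans (by gcongr; simp only [L]; linarith)
      _ = B * (‖z‖ * L) ^ n := by rw [mul_pow]; ring
      _ ≤ _ := by gcongr; exact hzL z hz
  have hder : ∀ z ∈ Metric.ball (0 : ℂ) r₂, HasDerivAt (fun z => ∑' n, z ^ n • Y n)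
      (A (t₀ + z) * ∑' n, z ^ n • Y n) z := by
    intro z hz
    have key : HasDerivAt (fun z => ∑' n, z ^ n • Y n)
        (∑' n : ℕ, ((n : ℂ) * z ^ (n - 1)) • Y n) z := by
      refine hasDerivAt_tsum_of_isPreconnected
        (u := fun n : ℕ => ‖(1 : 𝔸)‖ * 2 * L * ((n : ℝ) ^ 1 * (1 / 2) ^ n)) ?_ Metric.isOpen_ball
        (convex_ball (0 : ℂ) r₂).isPreconnected (g := fun (n : ℕ) z => z ^ n • Y n)
        (g' := fun (n : ℕ) z => ((n : ℂ) * z ^ (n - 1)) • Y n) ?_ ?_ hz (hsY z hz).of_norm hz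
      · exact (summable_pow_mul_geometric_of_norm_lt_one 1
          (by norm_num : ‖(1 / 2 : ℝ)‖ < 1)).mul_left _
      · intro n y _
        exact (hasDerivAt_pow n y).smul_const (Y n)
      · intro n y hy
        rcases n with _ | n
        · simp
        · simp only [Nat.add_sub_cancel]
          have h1 : ‖((n + 1 : ℕ) : ℂ)‖ = ((n + 1 : ℕ) : ℝ) := by simp only [Complex.norm_natCast]
          rw [norm_smul, norm_mul, norm_pow, h1]
          calc ((n + 1 : ℕ) : ℝ) * ‖y‖ ^ n * ‖Y (n + 1)‖
              ≤ ((n + 1 : ℕ) : ℝ) * ‖y‖ ^ n * (‖(1 : 𝔸)‖ * L ^ (n + 1)) := by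
                gcongr; exact hY _
            _ = ‖(1 : 𝔸)‖ * 2 * L * (((n + 1 : ℕ) : ℝ) ^ 1 * (1 / 2 * (‖y‖ * L) ^ n)) := by
                rw [mul_pow]; ring
            _ ≤ ‖(1 : 𝔸)‖ * 2 * L * (((n + 1 : ℕ) : ℝ) ^ 1 * (1 / 2 * (1 / 2) ^ n)) := by
                gcongr; exact hzL y hy
            _ = _ := by rw [pow_succ (1 / 2 : ℝ) n]; ring
    have hsd : Summable fun n : ℕ => ((n : ℂ) * z ^ (n - 1)) • Y n := by
      refine (summable_nat_add_iff 1).1 ?_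
      have h5 := (summable_norm_sum_mul_range_of_summable_norm (hsa z hz) (hsY z hz)).of_norm
      refine h5.congr fun n => ?_
      simp only [Nat.add_sub_cancel]
      push_cast
      rw [mul_comm, ← smul_smul, odeCoeff_succ, Finset.smul_sum]
      refine Finset.sum_congr rfl fun j hj => ?_
      have hj' : j ≤ n := by simpa [Nat.lt_succ_iff] using hj
      rw [smul_mul_smul_comm, ← pow_add, Nat.add_sub_cancel' hj']
    have hAz : A (t₀ + z) = ∑' n, z ^ n • a n := by
      refine (HasSum.tsum_eq (hsum ?_)).symm
      rw [dist_zero_right]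
      exact (mem_ball_zero_iff.1 hz).trans_le (min_le_left _ _)
    -- The recursion for the coefficients says that the differentiated series is the Cauchy product
    -- of the series of `A` and of the solution.
    convert! key using 1
    rw [hAz, tsum_mul_tsum_eq_tsum_sum_range_of_summable_norm (hsa z hz) (hsY z hz),
      hsd.tsum_eq_zero_add]
    simp only [Nat.cast_zero, zero_mul, zero_smul, zero_add, Nat.add_sub_cancel]
    refine tsum_congr fun n => ?_
    push_cast
    rw [mul_comm, ← smul_smul, odeCoeff_succ, Finset.smul_sum]
    refine Finset.sum_congr rfl fun j hj => ?_
    have hj' : j ≤ n := by simpa [Nat.lt_succ_iff] using hj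
    rw [smul_mul_smul_comm, ← pow_add, Nat.add_sub_cancel' hj']
  set Φ : ℂ → 𝔸 := fun t => ∑' n, (t - t₀) ^ n • Y n
  have hΦ₀ : Φ t₀ = 1 := by
    have : Φ t₀ = ∑' n, (0 : ℂ) ^ n • Y n := by simp [Φ]
    rw [this, tsum_eq_single 0 (fun n hn => by simp [hn])]
    simp [Y, odeCoeff]
  have hΦ : ∀ t ∈ Metric.ball t₀ r₂, HasDerivAt Φ (A t * Φ t) t := by
    intro t ht
    have h := hder (t - t₀) (by rwa [mem_ball_zero_iff, ← mem_ball_iff_norm])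
    have h2 := h.comp_sub_const t t₀
    simpa [Φ] using h2
  have hunit : ∀ᶠ t in 𝓝 t₀, IsUnit (Φ t) := by
    have hc := (hΦ t₀ (Metric.mem_ball_self hr₂)).continuousAt
    refine hc.eventually_mem (Units.isOpen.mem_nhds ?_)
    rw [hΦ₀]; exact isUnit_one
  obtain ⟨r₃, hr₃, h₃⟩ := Metric.eventually_nhds_iff.1 hunit
  refine ⟨min r₂ r₃, by positivity, Φ, hΦ₀, fun t ht => ⟨hΦ t ?_, h₃ ?_⟩⟩
  · exact Metric.ball_subset_ball (min_le_left _ _) ht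
  · exact (Metric.mem_ball.1 ht).trans_le (min_le_right _ _)

/-- A copy of a type with the discrete topology. -/
def DiscreteCopy (X : Type*) := X

instance (X : Type*) : TopologicalSpace (DiscreteCopy X) := ⊥
instance (X : Type*) : DiscreteTopology (DiscreteCopy X) := ⟨rfl⟩

/-- Left multiplication on the discrete copy of a ring. -/
def DiscreteCopy.lmul {R : Type*} [Mul R] (g : R) (v : DiscreteCopy R) : DiscreteCopy R :=
  @HMul.hMul R R R _ g v

lemma DiscreteCopy.one_lmul {R : Type*} [Monoid R] (v : DiscreteCopy R) : lmul 1 v = v :=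
  one_mul (M := R) v

lemma DiscreteCopy.lmul_lmul {R : Type*} [Monoid R] (g h : R) (v : DiscreteCopy R) :
    lmul g (lmul h v) = lmul (g * h) v :=
  (mul_assoc (G := R) g h v).symm

/-- Two solutions of `Y' = A Y`, the first of them invertible, differ by a right factor which has
vanishing derivative. -/
lemma hasDerivAt_inverse_mul {A Φ Ψ : ℂ → 𝔸} {t : ℂ} (hΦ : HasDerivAt Φ (A t * Φ t) t)
    (hu : IsUnit (Φ t)) (hΨ : HasDerivAt Ψ (A t * Ψ t) t) :
    HasDerivAt (fun t => Ring.inverse (Φ t) * Ψ t) 0 t := by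
  obtain ⟨u, hu⟩ := hu
  have h1 := (hasFDerivAt_ringInverse (𝕜 := ℂ) u)
  rw [hu] at h1
  have h2 := (h1.comp_hasDerivAt t hΦ).mul hΨ
  convert! h2 using 1
  simp only [Function.comp_apply, ← hu, Ring.inverse_unit]
  simp [mul_assoc]

/-- A holomorphic linear differential equation on a simply connected domain has a global
fundamental solution. -/
theorem exists_fundamental_solution {D : Set ℂ} (hD : IsOpen D) (hsc : IsSimplyConnected D)
    {A : ℂ → 𝔸} (hA : DifferentiableOn ℂ A D) {t₀ : ℂ} (ht₀ : t₀ ∈ D) :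
    ∃ Φ : ℂ → 𝔸, Φ t₀ = 1 ∧ ∀ t ∈ D, HasDerivAt Φ (A t * Φ t) t := by
  classical
  have hloc : ∀ i : D, ∃ r > 0, ∃ Φ : ℂ → 𝔸, Φ i = 1 ∧
      ∀ t ∈ Metric.ball (i : ℂ) r, HasDerivAt Φ (A t * Φ t) t ∧ IsUnit (Φ t) := fun i =>
    exists_local_fundamental (hA.analyticAt (hD.mem_nhds i.2))
  choose r hr Φ hΦ1 hΦ using hloc
  have hconst : ∀ i j : D, ∃ g : 𝔸, ∀ t ∈ Metric.ball (i : ℂ) (r i) ∩ Metric.ball (j : ℂ) (r j),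
      Ring.inverse (Φ j t) * Φ i t = g := by
    intro i j
    set s := Metric.ball (i : ℂ) (r i) ∩ Metric.ball (j : ℂ) (r j)
    have hs : IsOpen s := Metric.isOpen_ball.inter Metric.isOpen_ball
    have hd : ∀ t ∈ s, HasDerivAt (fun t => Ring.inverse (Φ j t) * Φ i t) 0 t := fun t ht =>
      hasDerivAt_inverse_mul (hΦ j t ht.2).1 (hΦ j t ht.2).2 (hΦ i t ht.1).1
    exact hs.exists_is_const_of_deriv_eq_zero
      ((convex_ball _ _).inter (convex_ball _ _)).isPreconnected
      (fun t ht => (hd t ht).differentiableAt.differentiableWithinAt) (fun t ht => (hd t ht).deriv)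
  -- Analytic continuation as a covering: local solutions `Φ i * g` are coordinatized by the
  -- constant `g`, and the transition factors `Φ_j⁻¹ Φ_i` are constant on overlaps of balls. With
  -- discrete fibres the bundle of germs of solutions covers `D`, and lifting the identity gives a
  -- global solution.
  let Z : FiberBundleCore D D (DiscreteCopy 𝔸) :=
    { baseSet := fun i => {t : D | (t : ℂ) ∈ Metric.ball (i : ℂ) (r i)}
      isOpen_baseSet := fun i => Metric.isOpen_ball.preimage continuous_subtype_val
      indexAt := id
      mem_baseSet_at := fun x => Metric.mem_ball_self (hr x)
      coordChange := fun i j t v => DiscreteCopy.lmul (Ring.inverse (Φ j t) * Φ i t) v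
      coordChange_self := fun i x hx v => by
        rw [Ring.inverse_mul_cancel _ (hΦ i x hx).2, DiscreteCopy.one_lmul]
      continuousOn_coordChange := fun i j => by
        obtain ⟨g, hg⟩ := hconst i j
        have hc : Continuous fun p : D × DiscreteCopy 𝔸 => DiscreteCopy.lmul g p.2 :=
          (continuous_of_discreteTopology (f := DiscreteCopy.lmul g)).comp continuous_snd
        refine hc.continuousOn.congr fun p hp => ?_
        have h := hg p.1 hp.1
        simp only [h]
      coordChange_comp := fun i j l x hx v => by
        have h := Ring.mul_inverse_cancel _ (hΦ j x hx.1.2).2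
        rw [DiscreteCopy.lmul_lmul, mul_assoc, ← mul_assoc (Φ j x), h, one_mul] }
  have hcov : IsCoveringMap (Bundle.TotalSpace.proj : Z.TotalSpace → D) :=
    FiberBundle.isCoveringMap (F := DiscreteCopy 𝔸) (E := Z.Fiber)
  have := hsc.simplyConnectedSpace
  have := hD.locallyPathConnectedSpace
  obtain ⟨σ, ⟨hσ0, hσ⟩, -⟩ := hcov.existsUnique_continuousMap_lifts (ContinuousMap.id D)
    ⟨t₀, ht₀⟩ (⟨⟨t₀, ht₀⟩, (1 : 𝔸)⟩ : Z.TotalSpace) rfl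
  have hσ' : ∀ t, (σ t).1 = t := fun t => congrFun hσ t
  let val : D → 𝔸 := fun t => (σ t).2
  have hval : ∀ i : D, ∃ g : 𝔸, ∀ᶠ t in 𝓝 i, val t = Φ i t * g := by
    intro i
    let e := Z.localTriv i
    have hmem : ∀ t : D, (t : ℂ) ∈ Metric.ball (i : ℂ) (r i) → σ t ∈ e.source := fun t ht => by
      rw [e.mem_source]
      show (((σ t).1 : D) : ℂ) ∈ Metric.ball (i : ℂ) (r i)
      rw [hσ']; exact ht
    have hc : ContinuousAt (fun t => (e (σ t)).2) i :=
      (continuous_snd.continuousAt.comp (e.continuousAt (hmem i (Metric.mem_ball_self (hr i))))).comp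
        σ.continuous.continuousAt
    have hev : ∀ᶠ t in 𝓝 i, (e (σ t)).2 = (e (σ i)).2 := by
      have := hc.eventually_mem (s := {(e (σ i)).2}) ((isOpen_discrete _).mem_nhds rfl)
      exact this
    refine ⟨((e (σ i)).2 : DiscreteCopy 𝔸), ?_⟩
    have hball : ∀ᶠ t : D in 𝓝 i, (t : ℂ) ∈ Metric.ball (i : ℂ) (r i) :=
      continuous_subtype_val.continuousAt.eventually_mem (Metric.ball_mem_nhds _ (hr i))
    filter_upwards [hev, hball] with t h1 h2
    rw [← h1]
    -- The fibre over `t` is read in the chart centred at `t`, where `Φ_t(t) = 1`; thus `val t` is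
    -- the value of the solution itself.
    show val t = Φ i t * (Ring.inverse (Φ i ((σ t).1 : D)) * Φ (σ t).1 ((σ t).1 : D) * val t)
    rw [hΦ1, mul_one, hσ', ← mul_assoc, Ring.mul_inverse_cancel _ (hΦ i t h2).2, one_mul]
  refine ⟨fun t => if h : t ∈ D then val ⟨t, h⟩ else 0, ?_, ?_⟩
  · simp only [ht₀, dif_pos]
    show (σ ⟨t₀, ht₀⟩).2 = (1 : 𝔸)
    rw [hσ0]
  · intro t ht
    obtain ⟨g, hg⟩ := hval ⟨t, ht⟩
    have heq : (fun t => if h : t ∈ D then val ⟨t, h⟩ else 0) =ᶠ[𝓝 t]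
        fun x => Φ ⟨t, ht⟩ x * g := by
      rw [nhds_subtype_eq_comap, eventually_comap] at hg
      filter_upwards [hg, hD.mem_nhds ht] with x hx hxD
      simp only [hxD, dif_pos]
      exact hx ⟨x, hxD⟩ rfl
    have h1 := (hΦ ⟨t, ht⟩ t (Metric.mem_ball_self (hr _))).1.mul_const g
    have h2 := h1.congr_of_eventuallyEq heq
    convert! h2 using 1
    exact (congrArg (A t * ·) heq.eq_of_nhds).trans (mul_assoc _ _ _).symm

end LinearODE

/-! ### The vectors `(A_{k-2n}⁻¹ K) ⋯ (A_{k-2}⁻¹ K) T` -/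

lemma forall_fin_three {p : Fin 3 → Prop} (h0 : p 0) (h1 : p 1) (h2 : p 2) : ∀ i, p i := by
  intro i; fin_cases i <;> assumption

lemma fin3_01 : (0 : Fin 3) + 1 = 1 := rfl
lemma fin3_02 : (0 : Fin 3) + 2 = 2 := rfl
lemma fin3_11 : (1 : Fin 3) + 1 = 2 := rfl
lemma fin3_12 : (1 : Fin 3) + 2 = 0 := rfl
lemma fin3_21 : (2 : Fin 3) + 1 = 0 := rfl
lemma fin3_22 : (2 : Fin 3) + 2 = 1 := rfl

lemma sum_fin_three_cyclic {R : Type*} [AddCommMonoid R] (f : Fin 3 → R) (i : Fin 3) :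
    ∑ j, f j = f i + f (i + 1) + f (i + 2) := by
  rw [Fin.sum_univ_three]
  revert i
  refine forall_fin_three ?_ ?_ ?_ <;>
    simp only [fin3_01, fin3_02, fin3_11, fin3_12, fin3_21, fin3_22] <;> abel

lemma cross_apply' (u v : Fin 3 → ℂ) (i : Fin 3) :
    (u ⨯₃ v) i = u (i + 1) * v (i + 2) - u (i + 2) * v (i + 1) := by
  revert i
  refine forall_fin_three ?_ ?_ ?_ <;>
    simp only [fin3_01, fin3_02, fin3_11, fin3_12, fin3_21, fin3_22, cross_apply] <;> simp

/-- The differences `a_γ - a_β`, `(α, β, γ)` cyclic. -/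
def diffs (a : Fin 3 → ℂ) (i : Fin 3) : ℂ := a (i + 2) - a (i + 1)

lemma sub_ne_zero_of_injective {a : Fin 3 → ℂ} (ha : Function.Injective a) {i j : Fin 3}
    (h : i ≠ j) : a i - a j ≠ 0 := sub_ne_zero.2 (ha.ne h)

lemma diffs_ne_zero {a : Fin 3 → ℂ} (ha : Function.Injective a) (i : Fin 3) : diffs a i ≠ 0 := by
  refine sub_ne_zero_of_injective ha ?_
  revert i; decide

lemma matA_mulVec (a : Fin 3 → ℂ) (k : ℂ) (n : ℕ) (v : Fin 3 → ℂ) (i : Fin 3) :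
    (matA a (k • a) n *ᵥ v) i =
      -(n * diffs a i * v i) + k * (v (i + 1) * a (i + 2) - v (i + 2) * a (i + 1)) := by
  revert i
  refine forall_fin_three ?_ ?_ ?_ <;>
    simp [fin3_11, fin3_12, fin3_21, fin3_22, matA, diffs,
      Matrix.mulVec, dotProduct, Fin.sum_univ_three] <;> ring

lemma det_matA (a : Fin 3 → ℂ) (k : ℂ) (n : ℕ) :
    (matA a (k • a) n).det =
      n * (k ^ 2 - n ^ 2) * ((a 2 - a 1) * (a 0 - a 2) * (a 1 - a 0)) := by
  simp [Matrix.det_fin_three, matA]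
  ring

lemma isUnit_det_matA {a : Fin 3 → ℂ} (ha : Function.Injective a) {k n : ℕ} (hn : 0 < n)
    (hnk : n < k) : IsUnit (matA a ((k : ℂ) • a) n).det := by
  rw [det_matA, isUnit_iff_ne_zero]
  refine mul_ne_zero (mul_ne_zero (by exact_mod_cast hn.ne') ?_) (mul_ne_zero (mul_ne_zero
    (sub_ne_zero_of_injective ha (by decide)) (sub_ne_zero_of_injective ha (by decide)))
    (sub_ne_zero_of_injective ha (by decide)))
  rw [sub_ne_zero]
  norm_cast
  exact (Nat.pow_lt_pow_left hnk two_ne_zero).ne'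

/-- The kernel of `A_k` consists of the multiples of `(1, 1, 1)`. -/
lemma apply_eq_of_matA_mulVec_eq_zero {a : Fin 3 → ℂ} (ha : Function.Injective a) {k : ℕ}
    (hk : k ≠ 0) {T : Fin 3 → ℂ} (hT : matA a ((k : ℂ) • a) k *ᵥ T = 0) (i : Fin 3) :
    T i = T 0 := by
  have hk' : (k : ℂ) ≠ 0 := by exact_mod_cast hk
  have h : ∀ i, -(diffs a i * T i) + (T (i + 1) * a (i + 2) - T (i + 2) * a (i + 1)) = 0 := by
    intro i
    have := congrFun hT i
    rw [matA_mulVec] at this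
    refine (mul_eq_zero.1 ?_).resolve_left hk'
    simp only [Pi.zero_apply] at this
    linear_combination this
  have h0 := h 0
  have h1 := h 1
  have h2 := h 2
  simp only [fin3_01, fin3_02, fin3_11, fin3_12, fin3_21, fin3_22, diffs] at h0 h1 h2
  -- At most one `a i` vanishes, so at least two of these three products force equalities among the
  -- `T i`.
  have e2 : a 2 * (T 0 - T 1) = 0 := by linear_combination (-h0 - h1 + h2) / 2
  have e0 : a 0 * (T 1 - T 2) = 0 := by linear_combination (h0 - h1 - h2) / 2
  have e1 : a 1 * (T 2 - T 0) = 0 := by linear_combination (-h0 + h1 - h2) / 2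
  have key : T 1 = T 0 ∧ T 2 = T 0 := by
    by_cases h2' : a 2 = 0
    · have h0' : a 0 ≠ 0 := fun h => by simpa using ha (h.trans h2'.symm)
      have h1' : a 1 ≠ 0 := fun h => by simpa using ha (h.trans h2'.symm)
      have f0 := sub_eq_zero.1 ((mul_eq_zero.1 e0).resolve_left h0')
      have f1 := sub_eq_zero.1 ((mul_eq_zero.1 e1).resolve_left h1')
      exact ⟨f0.trans f1, f1⟩
    · have f2 := sub_eq_zero.1 ((mul_eq_zero.1 e2).resolve_left h2')
      by_cases h1' : a 1 = 0
      · have h0' : a 0 ≠ 0 := fun h => by simpa using ha (h.trans h1'.symm)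
        have f0 := sub_eq_zero.1 ((mul_eq_zero.1 e0).resolve_left h0')
        exact ⟨f2.symm, f0.symm.trans f2.symm⟩
      · have f1 := sub_eq_zero.1 ((mul_eq_zero.1 e1).resolve_left h1')
        exact ⟨f2.symm, f1⟩
  revert i
  exact forall_fin_three rfl key.1 key.2

/-- The product of the last `n` of the `s` factors `A_j⁻¹ K`, applied to `T`. -/
def vecH (a : Fin 3 → ℂ) (k s : ℕ) (T K : Fin 3 → ℂ) : ℕ → Fin 3 → ℂ
  | 0 => T
  | n + 1 => (matA a ((k : ℂ) • a) (2 * (s - 1 - n) + 1))⁻¹ *ᵥ (K * vecH a k s T K n)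

section
variable (a : Fin 3 → ℂ) (k s : ℕ) (T K : Fin 3 → ℂ)

/-- The recursion `vecH` applies the factors from the right, so after `n` steps the indices run over
`s - n, …, s - 1`; the shift keeps the induction going. -/
lemma prod_mulVec_eq_vecH_aux {n : ℕ} (hn : n ≤ s) :
    ((List.range n).map fun j => (matA a ((k : ℂ) • a) (2 * (j + (s - n)) + 1))⁻¹ *
      Matrix.diagonal K).prod *ᵥ T = vecH a k s T K n := by
  induction n with
  | zero => simp [vecH]
  | succ n ih =>
    rw [List.range_succ_eq_map, List.map_cons, List.map_map, List.prod_cons,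
      ← Matrix.mulVec_mulVec, vecH, ← ih (by omega), ← Matrix.mulVec_mulVec]
    congr 2
    · congr 2; omega
    · ext i
      rw [Matrix.mulVec_diagonal, Pi.mul_apply]
      congr 4
      ext1 j
      simp only [Function.comp_apply]
      congr 3
      omega

lemma prod_mulVec_eq_vecH :
    ((List.range s).map fun j => (matA a ((k : ℂ) • a) (2 * j + 1))⁻¹ *
      Matrix.diagonal K).prod *ᵥ T = vecH a k s T K s := by
  simpa using prod_mulVec_eq_vecH_aux a k s T K le_rfl

lemma vecP_apply (M : Fin 3 → ℂ) (i : Fin 3) :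
    vecP a k s T M i = M i * vecH a k s T (M ^ 2) s i := by
  rw [vecP, prod_mulVec_eq_vecH, Pi.mul_apply]

lemma polyF_eval (c x : ℂ) (i : Fin 3) :
    (polyF a c k s T i).eval x = vecH a k s T (fun i => kap a c i * (x - a i)) s i := by
  rw [← prod_mulVec_eq_vecH, polyF, ← coe_evalRingHom, RingHom.map_mulVec]
  congr 1
  · rw [← RingHom.mapMatrix_apply, map_list_prod, List.map_map]
    congr 2
    ext1 j
    simp only [Function.comp_apply, map_mul, RingHom.mapMatrix_apply, Matrix.map_map]
    congr 1
    · ext; simp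
    · rw [Matrix.diagonal_map (by simp)]
      simp
  · ext; simp

lemma vecH_smul (u : ℂ) (n : ℕ) : vecH a k s T (u • K) n = u ^ n • vecH a k s T K n := by
  induction n with
  | zero => simp [vecH]
  | succ n ih =>
    rw [vecH, ih, vecH, smul_mul_smul_comm, Matrix.mulVec_smul, pow_succ' u]

lemma natDegree_polyF_le (c : ℂ) (i : Fin 3) : (polyF a c k s T i).natDegree ≤ s := by
  have key : ∀ (l : List ℕ) (i : Fin 3), (((l.map fun j =>
      ((matA a ((k : ℂ) • a) (2 * j + 1))⁻¹).map C *
      Matrix.diagonal (fun i => C (kap a c i) * (X - C (a i)))).prod *ᵥ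
        (fun i => C (T i))) i).natDegree ≤ l.length := by
    intro l
    induction l with
    | nil => intro i; simp
    | cons j l ih =>
      intro i
      rw [List.map_cons, List.prod_cons, ← Matrix.mulVec_mulVec, ← Matrix.mulVec_mulVec,
        Matrix.mulVec, dotProduct, List.length_cons]
      refine natDegree_sum_le_of_forall_le _ _ fun m _ => ?_
      rw [Matrix.mulVec_diagonal, Matrix.map_apply]
      refine (natDegree_C_mul_le _ _).trans ?_
      refine natDegree_mul_le.trans ?_
      have h1 : (C (kap a c m) * (X - C (a m))).natDegree ≤ 1 :=
        (natDegree_C_mul_le _ _).trans (natDegree_X_sub_C_le _)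
      have := ih m
      omega
  simpa [polyF] using key (List.range s) i

end

/-! ### Differentiation along `K' = 2 π d` and the quadratic integral. -/

section
variable {a : Fin 3 → ℂ} {k s : ℕ} {T : Fin 3 → ℂ}

lemma matA_mulVec_vecH_succ (ha : Function.Injective a) (hk : k = 2 * s + 1) (K : Fin 3 → ℂ)
    {n : ℕ} (hn : n < s) :
    matA a ((k : ℂ) • a) (2 * (s - 1 - n) + 1) *ᵥ vecH a k s T K (n + 1) =
      K * vecH a k s T K n := by
  rw [vecH, Matrix.mulVec_mulVec, Matrix.mul_nonsing_inv _ (isUnit_det_matA ha (by omega) (by omega)),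
    Matrix.one_mulVec]

lemma eq_zero_of_vecH_eq_zero (ha : Function.Injective a) (hk : k = 2 * s + 1) {K : Fin 3 → ℂ}
    (hK : ∀ i, K i ≠ 0) {n : ℕ} (hn : n ≤ s) (h : vecH a k s T K n = 0) : T = 0 := by
  induction n with
  | zero => exact h
  | succ n ih =>
    refine ih (by omega) ?_
    have h1 := matA_mulVec_vecH_succ (T := T) ha hk K (n := n) (by omega)
    rw [h, Matrix.mulVec_zero] at h1
    ext i
    exact (mul_eq_zero.1 (congrFun h1 i).symm).resolve_left (hK i)

/-- The value of the vectors at the point `λ = c`. -/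
lemma exists_vecH_diffs (ha : Function.Injective a) (hk : k = 2 * s + 1)
    (hTker : matA a ((k : ℂ) • a) k *ᵥ T = 0) {n : ℕ} (hn : n ≤ s) :
    ∃ ρ : ℂ, ρ ≠ 0 ∧ ∀ i, vecH a k s T (diffs a) n i = ρ * T 0 := by
  induction n with
  | zero =>
    exact ⟨1, one_ne_zero, fun i => by
      rw [one_mul, vecH, apply_eq_of_matA_mulVec_eq_zero ha (by omega) hTker]⟩
  | succ n ih =>
    obtain ⟨ρ, hρ, h⟩ := ih (by omega)
    have hn0 : (2 * (n + 1) : ℂ) ≠ 0 := by exact_mod_cast (by omega : 2 * (n + 1) ≠ 0)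
    refine ⟨ρ / (2 * (n + 1)), div_ne_zero hρ hn0, fun i => ?_⟩
    -- `A_j (1,1,1) = (k - j) d`, and here `k - j = 2 (n + 1)`.
    have h1 : diffs a * vecH a k s T (diffs a) n = matA a ((k : ℂ) • a) (2 * (s - 1 - n) + 1) *ᵥ
        fun _ => ρ / (2 * (n + 1)) * T 0 := by
      ext i
      rw [matA_mulVec, Pi.mul_apply, h]
      obtain ⟨m, rfl⟩ : ∃ m, s = m + 1 + n := ⟨s - 1 - n, by omega⟩
      rw [show m + 1 + n - 1 - n = m by omega, hk]
      simp only [diffs]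
      field_simp
      push_cast
      ring
    rw [vecH, h1, Matrix.mulVec_mulVec,
      Matrix.nonsing_inv_mul _ (isUnit_det_matA ha (by omega) (by omega)), Matrix.one_mulVec]

/-- `(K H_n)' = π (2 d H_n + K H_{n-1}) = π (2 d + A_{k-2n}) H_n = π A_{k-2n-2} H_n`, and
`A_{k-2n-2}⁻¹` removes the matrix. For `n = 0` the equation `A_k T = 0` replaces `A_{k-2n} H_n = K
H_{n-1}`. -/
lemma hasDerivAt_vecH_succ (ha : Function.Injective a) (hk : k = 2 * s + 1)
    (hTker : matA a ((k : ℂ) • a) k *ᵥ T = 0) {K : ℂ → Fin 3 → ℂ} {π t : ℂ}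
    (hK : ∀ i, HasDerivAt (fun t => K t i) (2 * π * diffs a i) t) {n : ℕ} (hn : n < s) (i : Fin 3) :
    HasDerivAt (fun t => vecH a k s T (K t) (n + 1) i) (π * vecH a k s T (K t) n i) t := by
  induction n generalizing i with
  | zero =>
    have h1 : ∀ i, HasDerivAt (fun t => (K t * vecH a k s T (K t) 0) i)
        ((π • (matA a ((k : ℂ) • a) (2 * (s - 1) + 1) *ᵥ T)) i) t := by
      intro i
      convert! (hK i).mul_const (T i) using 1
      have h2 := congrFun hTker i
      rw [matA_mulVec] at h2
      rw [Pi.smul_apply, smul_eq_mul, matA_mulVec]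
      obtain ⟨m, rfl⟩ : ∃ m, s = m + 1 := ⟨s - 1, by omega⟩
      simp only [Nat.add_sub_cancel, Pi.zero_apply] at h2 ⊢
      subst hk
      push_cast at h2 ⊢
      linear_combination π * h2
    have h3 : HasDerivAt (fun t => vecH a k s T (K t) 1 i)
        (((matA a ((k : ℂ) • a) (2 * (s - 1) + 1))⁻¹ *ᵥ
          (π • (matA a ((k : ℂ) • a) (2 * (s - 1) + 1) *ᵥ T))) i) t := by
      simp only [vecH, Matrix.mulVec, dotProduct, Nat.sub_zero]
      exact HasDerivAt.fun_sum fun j _ => (h1 j).const_mul _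
    rw [Matrix.mulVec_smul, Matrix.mulVec_mulVec,
      Matrix.nonsing_inv_mul _ (isUnit_det_matA ha (by omega) (by omega)), Matrix.one_mulVec] at h3
    exact h3
  | succ n ih =>
    have h1 : ∀ i, HasDerivAt (fun t => (K t * vecH a k s T (K t) (n + 1)) i)
        ((π • (matA a ((k : ℂ) • a) (2 * (s - 1 - (n + 1)) + 1) *ᵥ
          vecH a k s T (K t) (n + 1))) i) t := by
      intro i
      convert! (hK i).mul (ih (by omega) i) using 1
      have h2 := congrFun (matA_mulVec_vecH_succ (T := T) ha hk (K t) (n := n) (by omega)) i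
      rw [matA_mulVec, Pi.mul_apply] at h2
      rw [Pi.smul_apply, smul_eq_mul, matA_mulVec]
      obtain ⟨m, rfl⟩ : ∃ m, s = m + 2 + n := ⟨s - 2 - n, by omega⟩
      rw [show m + 2 + n - 1 - n = m + 1 by omega] at h2
      rw [show m + 2 + n - 1 - (n + 1) = m by omega]
      push_cast at h2 ⊢
      linear_combination π * h2
    have h3 : HasDerivAt (fun t => vecH a k s T (K t) (n + 1 + 1) i)
        (((matA a ((k : ℂ) • a) (2 * (s - 1 - (n + 1)) + 1))⁻¹ *ᵥ
          (π • (matA a ((k : ℂ) • a) (2 * (s - 1 - (n + 1)) + 1) *ᵥ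
            vecH a k s T (K t) (n + 1)))) i) t := by
      rw [show (fun t => vecH a k s T (K t) (n + 1 + 1) i) = fun t =>
        ((matA a ((k : ℂ) • a) (2 * (s - 1 - (n + 1)) + 1))⁻¹ *ᵥ
          (K t * vecH a k s T (K t) (n + 1))) i from rfl]
      simp only [Matrix.mulVec, dotProduct]
      exact HasDerivAt.fun_sum fun j _ => (h1 j).const_mul _
    rw [Matrix.mulVec_smul, Matrix.mulVec_mulVec,
      Matrix.nonsing_inv_mul _ (isUnit_det_matA ha (by omega) (by omega)), Matrix.one_mulVec] at h3
    exact h3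

/-- If `K' = 2 π d`, `d = (a_γ - a_β)`, then `H' = π h` with `K h = A₁ H`. -/
lemma exists_hasDerivAt_vecH (ha : Function.Injective a) (hs : 1 ≤ s) (hk : k = 2 * s + 1)
    (hTker : matA a ((k : ℂ) • a) k *ᵥ T = 0) {K : ℂ → Fin 3 → ℂ} {π t : ℂ}
    (hK : ∀ i, HasDerivAt (fun t => K t i) (2 * π * diffs a i) t) :
    ∃ h : Fin 3 → ℂ, (∀ i, HasDerivAt (fun t => vecH a k s T (K t) s i) (π * h i) t) ∧
      ∀ i, K t i * h i + diffs a i * vecH a k s T (K t) s i =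
        k * (vecH a k s T (K t) s (i + 1) * a (i + 2) -
          vecH a k s T (K t) s (i + 2) * a (i + 1)) := by
  obtain ⟨n, rfl⟩ : ∃ n, s = n + 1 := ⟨s - 1, by omega⟩
  refine ⟨vecH a k (n + 1) T (K t) n,
    fun i => hasDerivAt_vecH_succ ha hk hTker hK (Nat.lt_succ_self n) i, fun i => ?_⟩
  have h2 := congrFun (matA_mulVec_vecH_succ (T := T) ha hk (K t) (n := n) (by omega)) i
  rw [matA_mulVec, Pi.mul_apply, show n + 1 - 1 - n = 0 by omega] at h2
  push_cast at h2
  linear_combination -h2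

lemma hasDerivAt_mul_vecH_sq (ha : Function.Injective a) (hs : 1 ≤ s) (hk : k = 2 * s + 1)
    (hTker : matA a ((k : ℂ) • a) k *ᵥ T = 0) {K : ℂ → Fin 3 → ℂ} {π t : ℂ}
    (hK : ∀ i, HasDerivAt (fun t => K t i) (2 * π * diffs a i) t) (i : Fin 3) :
    HasDerivAt (fun t => K t i * vecH a k s T (K t) s i ^ 2)
      (2 * π * k * vecH a k s T (K t) s i * (vecH a k s T (K t) s (i + 1) * a (i + 2) -
          vecH a k s T (K t) s (i + 2) * a (i + 1))) t := by
  obtain ⟨h, h1, h2⟩ := exists_hasDerivAt_vecH ha hs hk hTker hK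
  convert! (hK i).mul ((h1 i).pow 2) using 1
  simp only [Nat.cast_ofNat, Nat.add_one_sub_one, pow_one, Pi.pow_apply]
  linear_combination -(2 * π * vecH a k s T (K t) s i) * h2 i

/-- The quadratic integral `K₁ H₁² + K₂ H₂² + K₃ H₃²`. -/
def sqH (a : Fin 3 → ℂ) (k s : ℕ) (T K : Fin 3 → ℂ) : ℂ := ∑ i, K i * vecH a k s T K s i ^ 2

/-- The three derivatives `2 π k H_α (H_β a_γ - H_γ a_β)` cancel in the cyclic sum. -/
lemma hasDerivAt_sqH (ha : Function.Injective a) (hs : 1 ≤ s) (hk : k = 2 * s + 1)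
    (hTker : matA a ((k : ℂ) • a) k *ᵥ T = 0) {K : ℂ → Fin 3 → ℂ} {π t : ℂ}
    (hK : ∀ i, HasDerivAt (fun t => K t i) (2 * π * diffs a i) t) :
    HasDerivAt (fun t => sqH a k s T (K t)) 0 t := by
  have := HasDerivAt.fun_sum (u := Finset.univ) fun i _ =>
    hasDerivAt_mul_vecH_sq ha hs hk hTker hK i
  convert! this using 1
  rw [sum_fin_three_cyclic _ 0]
  simp only [fin3_01, fin3_02, fin3_11, fin3_12, fin3_21, fin3_22]
  ring

lemma sqH_smul (hk : k = 2 * s + 1) (u : ℂ) (K : Fin 3 → ℂ) :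
    sqH a k s T (u • K) = u ^ k * sqH a k s T K := by
  simp only [sqH, Finset.mul_sum, vecH_smul, Pi.smul_apply, smul_eq_mul]
  refine Finset.sum_congr rfl fun i _ => ?_
  rw [hk]; ring

end

/-! ### The parametrization by `λ` -/

section
variable {a : Fin 3 → ℂ} {c : ℂ}

/-- `∏ (aᵢ - c)` over `∏ (a_γ - a_β)`. -/
def kapRatio (a : Fin 3 → ℂ) (c : ℂ) : ℂ := (∏ i, (a i - c)) / ∏ i, diffs a i

lemma kapRatio_ne_zero (ha : Function.Injective a) (hc : ∀ i, c ≠ a i) : kapRatio a c ≠ 0 :=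
  div_ne_zero (Finset.prod_ne_zero_iff.2 fun i _ => sub_ne_zero.2 (hc i).symm)
    (Finset.prod_ne_zero_iff.2 fun i _ => diffs_ne_zero ha i)

lemma prod_fin_three_cyclic (f : Fin 3 → ℂ) (i : Fin 3) :
    ∏ j, f j = f i * f (i + 1) * f (i + 2) := by
  rw [Fin.prod_univ_three]
  revert i
  refine forall_fin_three ?_ ?_ ?_ <;>
    simp only [fin3_01, fin3_02, fin3_11, fin3_12, fin3_21, fin3_22] <;> ring

lemma fin3_add_one_add_one (i : Fin 3) : i + 1 + 1 = i + 2 := by revert i; decide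
lemma fin3_add_one_add_two (i : Fin 3) : i + 1 + 2 = i := by revert i; decide
lemma fin3_add_two_add_one (i : Fin 3) : i + 2 + 1 = i := by revert i; decide
lemma fin3_add_two_add_two (i : Fin 3) : i + 2 + 2 = i + 1 := by revert i; decide

lemma ne_add_one (i : Fin 3) : i ≠ i + 1 := by revert i; decide
lemma ne_add_two (i : Fin 3) : i ≠ i + 2 := by revert i; decide
lemma add_one_ne_add_two (i : Fin 3) : i + 1 ≠ i + 2 := by revert i; decide

/-- This identity makes `κ (λ - a) / (λ - c)` an affine line with direction `d` in the variable `(λ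
- c)⁻¹`, with `κ` itself at `λ = ∞`. -/
lemma kap_mul_sub (ha : Function.Injective a) (i : Fin 3) :
    kap a c i * (c - a i) = kapRatio a c * diffs a i := by
  have h1 := sub_ne_zero_of_injective ha (ne_add_one i)
  have h2 := sub_ne_zero_of_injective ha (ne_add_two i)
  have h3 := sub_ne_zero_of_injective ha (add_one_ne_add_two i)
  have h1' := sub_ne_zero_of_injective ha (ne_add_one i).symm
  have h2' := sub_ne_zero_of_injective ha (ne_add_two i).symm
  have h3' := sub_ne_zero_of_injective ha (add_one_ne_add_two i).symm
  rw [kapRatio, prod_fin_three_cyclic _ i, prod_fin_three_cyclic _ i, kap]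
  simp only [diffs, fin3_add_one_add_one, fin3_add_one_add_two, fin3_add_two_add_one,
    fin3_add_two_add_two]
  field_simp
  ring

lemma kap_mul_div (ha : Function.Injective a) {x : ℂ} (hx : x ≠ c) (i : Fin 3) :
    kap a c i * ((x - a i) / (x - c)) = kap a c i + kapRatio a c * diffs a i * (x - c)⁻¹ := by
  have := sub_ne_zero.2 hx
  rw [← kap_mul_sub ha]
  field_simp
  ring

lemma prod_kap (ha : Function.Injective a) : ∏ i, kap a c i = -kapRatio a c ^ 2 := by
  have h1 := sub_ne_zero_of_injective ha (by decide : (0 : Fin 3) ≠ 1)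
  have h2 := sub_ne_zero_of_injective ha (by decide : (0 : Fin 3) ≠ 2)
  have h3 := sub_ne_zero_of_injective ha (by decide : (1 : Fin 3) ≠ 2)
  have h1' := sub_ne_zero_of_injective ha (by decide : (1 : Fin 3) ≠ 0)
  have h2' := sub_ne_zero_of_injective ha (by decide : (2 : Fin 3) ≠ 0)
  have h3' := sub_ne_zero_of_injective ha (by decide : (2 : Fin 3) ≠ 1)
  rw [kapRatio, Fin.prod_univ_three, Fin.prod_univ_three, Fin.prod_univ_three]
  simp only [kap, diffs, fin3_01, fin3_02, fin3_11, fin3_12, fin3_21, fin3_22]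
  field_simp
  ring

/-- A vector with `K₁ + K₂ + K₃ = 1`, `a₁K₁ + a₂K₂ + a₃K₃ = c` lies on the line through
`(κ₁, κ₂, κ₃)` with direction `(a_γ - a_β)`. -/
lemma exists_eq_kap_add (ha : Function.Injective a) (hc : ∀ i, c ≠ a i) {K : Fin 3 → ℂ}
    (h1 : ∑ i, K i = 1) (h2 : ∑ i, a i * K i = c) :
    ∃ z, ∀ i, K i = kap a c i + kapRatio a c * diffs a i * z := by
  have h3 := sub_ne_zero_of_injective ha (by decide : (0 : Fin 3) ≠ 1)
  have h4 := sub_ne_zero_of_injective ha (by decide : (0 : Fin 3) ≠ 2)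
  have h5 := sub_ne_zero_of_injective ha (by decide : (1 : Fin 3) ≠ 2)
  have h3' := sub_ne_zero_of_injective ha (by decide : (1 : Fin 3) ≠ 0)
  have h4' := sub_ne_zero_of_injective ha (by decide : (2 : Fin 3) ≠ 0)
  have h5' := sub_ne_zero_of_injective ha (by decide : (2 : Fin 3) ≠ 1)
  have hE := kapRatio_ne_zero ha hc
  have hs : ∑ i, kap a c i = 1 := by
    rw [Fin.sum_univ_three]
    simp only [kap, fin3_01, fin3_02, fin3_11, fin3_12, fin3_21, fin3_22]
    field_simp
    ring
  have hs' : ∑ i, a i * kap a c i = c := by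
    rw [Fin.sum_univ_three]
    simp only [kap, fin3_01, fin3_02, fin3_11, fin3_12, fin3_21, fin3_22]
    field_simp
    ring
  rw [Fin.sum_univ_three] at h1 h2 hs hs'
  -- The vector `κ` satisfies both linear conditions, so `K - κ` is annihilated by `(1,1,1)` and by
  -- `a`, hence proportional to `d`.
  have e1 : K 1 - kap a c 1 = (K 0 - kap a c 0) * (a 0 - a 2) / (a 2 - a 1) := by
    field_simp
    linear_combination a 2 * (h1 - hs) - (h2 - hs')
  have e2 : K 2 - kap a c 2 = (K 0 - kap a c 0) * (a 1 - a 0) / (a 2 - a 1) := by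
    field_simp
    linear_combination -a 1 * (h1 - hs) + (h2 - hs')
  refine ⟨(K 0 - kap a c 0) / (kapRatio a c * (a 2 - a 1)), forall_fin_three ?_ ?_ ?_⟩
  · simp only [diffs, fin3_01, fin3_02]
    field_simp
    ring
  · rw [← sub_eq_iff_eq_add', e1]
    simp only [diffs, fin3_11, fin3_12]
    field_simp
  · rw [← sub_eq_iff_eq_add', e2]
    simp only [diffs, fin3_21, fin3_22]
    field_simp

variable {k s : ℕ} {T : Fin 3 → ℂ}

/-- The constant value of `K₁ H₁² + K₂ H₂² + K₃ H₃²` on the line `λ ↦ κ (λ - a) / (λ - c)`. -/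
def sqConst (a : Fin 3 → ℂ) (c : ℂ) (k s : ℕ) (T : Fin 3 → ℂ) : ℂ := sqH a k s T (kap a c)

lemma sqH_line (ha : Function.Injective a) (hs : 1 ≤ s) (hk : k = 2 * s + 1)
    (hTker : matA a ((k : ℂ) • a) k *ᵥ T = 0) (z : ℂ) :
    sqH a k s T (fun i => kap a c i + kapRatio a c * diffs a i * z) = sqConst a c k s T := by
  set K : ℂ → Fin 3 → ℂ := fun z i => kap a c i + kapRatio a c * diffs a i * z
  have hK : ∀ z i, HasDerivAt (fun z => K z i) (2 * (kapRatio a c / 2) * diffs a i) z := by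
    intro z i
    convert! ((hasDerivAt_id z).const_mul (kapRatio a c * diffs a i)).const_add (kap a c i) using 1
    ring
  have h := is_const_of_deriv_eq_zero
    (fun z => (hasDerivAt_sqH ha hs hk hTker (hK z)).differentiableAt)
    (fun z => (hasDerivAt_sqH ha hs hk hTker (hK z)).deriv) z 0
  refine h.trans ?_
  rw [sqConst]
  congr 1
  ext i
  simp [K]

lemma sqH_of_sums (ha : Function.Injective a) (hc : ∀ i, c ≠ a i) (hs : 1 ≤ s)
    (hk : k = 2 * s + 1) (hTker : matA a ((k : ℂ) • a) k *ᵥ T = 0) {K : Fin 3 → ℂ} {u : ℂ}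
    (hu : u ≠ 0) (h1 : ∑ i, K i = u) (h2 : ∑ i, a i * K i = c * u) :
    sqH a k s T K = u ^ k * sqConst a c k s T := by
  obtain ⟨z, hz⟩ := exists_eq_kap_add (K := u⁻¹ • K) ha hc
    (by simp only [Pi.smul_apply, smul_eq_mul]; rw [← Finset.mul_sum, h1, inv_mul_cancel₀ hu])
    (by
      have : ∀ i, a i * (u⁻¹ • K) i = u⁻¹ * (a i * K i) := fun i => by
        simp only [Pi.smul_apply, smul_eq_mul]; ring
      simp only [this]
      rw [← Finset.mul_sum, h2]
      field_simp)
  have h3 : K = u • fun i => kap a c i + kapRatio a c * diffs a i * z := by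
    rw [← funext hz, smul_inv_smul₀ hu]
  rw [h3, sqH_smul hk, sqH_line ha hs hk hTker]

/-- The values of `polyF` in terms of the parametrization. -/
lemma polyF_eval_of_ne {x : ℂ} (hx : x ≠ c) (i : Fin 3) :
    (polyF a c k s T i).eval x = (x - c) ^ s *
      vecH a k s T (fun i => kap a c i * ((x - a i) / (x - c))) s i := by
  have h : (fun i => kap a c i * (x - a i)) =
      (x - c) • fun i => kap a c i * ((x - a i) / (x - c)) := by
    ext i
    have := sub_ne_zero.2 hx
    simp only [Pi.smul_apply, smul_eq_mul]
    field_simp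
  rw [polyF_eval, h, vecH_smul, Pi.smul_apply, smul_eq_mul]

theorem polySq_eq (ha : Function.Injective a) (hs : 1 ≤ s)
    (hk : k = 2 * s + 1) (hTker : matA a ((k : ℂ) • a) k *ᵥ T = 0) :
    polySq a c k s T = C (sqConst a c k s T) * (X - C c) ^ k := by
  -- The parametrization is only available for `λ ≠ c`, which is enough for an identity of
  -- polynomials.
  refine eq_of_infinite_eval_eq _ _ (Set.Infinite.mono ?_ (Set.finite_singleton c).infinite_compl)
  intro x hx
  have hx' : x ≠ c := hx
  have hx0 := sub_ne_zero.2 hx'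
  have h1 := sqH_line (c := c) ha hs hk hTker (x - c)⁻¹
  simp only [Set.mem_ofPred_eq, polySq, eval_finsetSum, eval_mul, eval_C, eval_sub, eval_X,
    eval_pow, polyF_eval_of_ne hx', ← h1, sqH, Finset.sum_mul, kap_mul_div ha hx']
  refine Finset.sum_congr rfl fun i _ => ?_
  rw [← kap_mul_div ha hx', hk]
  field_simp
  ring

end

/-! ### Real motions -/

/-- Put a small weight `ε` on the arbitrary third value `z` and solve for the other two; at `ε = 0`
they are already positive. -/
lemma exists_pos_weights {x y c : ℝ} (z : ℝ) (hx : x < c) (hy : c < y) :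
    ∃ p q r : ℝ, 0 < p ∧ 0 < q ∧ 0 < r ∧ p + q + r = 1 ∧ x * p + y * q + z * r = c := by
  obtain ⟨ε, hε, h1, h2⟩ : ∃ ε : ℝ, 0 < ε ∧ 0 < c - x - ε * (z - x) ∧ 0 < y - c - ε * (y - z) := by
    have t1 : Tendsto (fun ε : ℝ => c - x - ε * (z - x)) (𝓝[>] 0) (𝓝 (c - x - 0 * (z - x))) :=
      (Continuous.tendsto (by fun_prop) _).mono_left nhdsWithin_le_nhds
    have t2 : Tendsto (fun ε : ℝ => y - c - ε * (y - z)) (𝓝[>] 0) (𝓝 (y - c - 0 * (y - z))) :=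
      (Continuous.tendsto (by fun_prop) _).mono_left nhdsWithin_le_nhds
    have e1 := t1.eventually_const_lt (u := 0) (by linarith)
    have e2 := t2.eventually_const_lt (u := 0) (by linarith)
    obtain ⟨ε, ⟨h1, h2⟩, h0⟩ := ((e1.and e2).and self_mem_nhdsWithin).exists
    exact ⟨ε, h0, h1, h2⟩
  have hxy : 0 < y - x := by linarith
  refine ⟨(y - c - ε * (y - z)) / (y - x), (c - x - ε * (z - x)) / (y - x), ε, div_pos h2 hxy,
    div_pos h1 hxy, hε, ?_, ?_⟩ <;> field_simp <;> ring

lemma exists_pos_vec {a : Fin 3 → ℝ} {c : ℝ} (h1 : ∃ i, a i < c) (h2 : ∃ i, c < a i) :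
    ∃ p : Fin 3 → ℝ, (∀ i, 0 < p i) ∧ ∑ i, p i = 1 ∧ ∑ i, a i * p i = c := by
  obtain ⟨i, hi⟩ := h1
  obtain ⟨j, hj⟩ := h2
  have hij : i ≠ j := fun h => by subst h; linarith
  obtain ⟨l, hli, hlj⟩ : ∃ l, l ≠ i ∧ l ≠ j := by
    clear hi hj; revert i j; decide
  obtain ⟨p, q, r, hp, hq, hr, e1, e2⟩ := exists_pos_weights (a l) hi hj
  have hu : (Finset.univ : Finset (Fin 3)) = {i, j, l} := by
    clear hi hj e2; revert i j l; decide
  have hsum : ∀ f : Fin 3 → ℝ, ∑ m, f m = f i + f j + f l := fun f => by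
    rw [hu, Finset.sum_insert (by simp [hij, hli.symm]), Finset.sum_pair hlj.symm, add_assoc]
  refine ⟨fun m => if m = i then p else if m = j then q else r, fun m => ?_, ?_, ?_⟩
  · dsimp only; split_ifs <;> assumption
  · rw [hsum]; simpa [hij.symm, hli, hlj] using e1
  · rw [hsum]; simpa [hij.symm, hli, hlj] using e2

lemma exists_real_inv {A : Matrix (Fin 3) (Fin 3) ℂ} {B : Matrix (Fin 3) (Fin 3) ℝ}
    (hA : IsUnit A.det) (h : A = B.map Complex.ofRealHom) :
    A⁻¹ = (B⁻¹).map Complex.ofRealHom := by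
  refine Matrix.inv_eq_left_inv ?_
  have hB : IsUnit B.det := by
    rw [h, ← RingHom.mapMatrix_apply, ← RingHom.map_det] at hA
    exact isUnit_iff_ne_zero.2 fun h0 => by simp [h0] at hA
  rw [h, ← Matrix.map_mul, Matrix.nonsing_inv_mul _ hB]
  simp

/-- All matrices are real and `T` is a scalar times `(1,1,1)`. Reality up to a common factor is what
prevents cancellation in the complex sum of squares. -/
lemma exists_real_vecH {a : Fin 3 → ℂ} {a' : Fin 3 → ℝ} (haa : ∀ i, a i = a' i)
    (ha : Function.Injective a) {k s : ℕ} (hk : k = 2 * s + 1) {T : Fin 3 → ℂ} {τ : ℂ}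
    (hT : ∀ i, T i = τ) {K : Fin 3 → ℂ} {p : Fin 3 → ℝ} (hK : ∀ i, K i = p i) {n : ℕ}
    (hn : n ≤ s) : ∃ v : Fin 3 → ℝ, ∀ i, vecH a k s T K n i = τ * v i := by
  induction n with
  | zero => exact ⟨1, fun i => by simp [vecH, hT]⟩
  | succ n ih =>
    obtain ⟨v, hv⟩ := ih (by omega)
    set m := 2 * (s - 1 - n) + 1
    set A := matA a ((k : ℂ) • a) m
    have hA : A = (A.map Complex.re).map Complex.ofRealHom := by
      obtain rfl : a = fun i => (a' i : ℂ) := funext haa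
      ext i j
      revert i j
      refine forall_fin_three ?_ ?_ ?_ <;> refine forall_fin_three ?_ ?_ ?_ <;>
        simp [A, matA]
    refine ⟨(A.map Complex.re)⁻¹ *ᵥ (p * v), fun i => ?_⟩
    rw [vecH, exists_real_inv (isUnit_det_matA ha (by omega) (by omega)) hA]
    simp only [Matrix.mulVec, dotProduct, Matrix.map_apply, Pi.mul_apply, hv, hK]
    push_cast
    rw [Finset.mul_sum]
    refine Finset.sum_congr rfl fun j _ => ?_
    simp only [Complex.ofRealHom_eq_coe]
    ring

theorem sqConst_ne_zero {a : Fin 3 → ℂ} (ha : Function.Injective a) {c : ℂ}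
    (hc : ∀ i, c ≠ a i) {k s : ℕ} (hs : 1 ≤ s) (hk : k = 2 * s + 1) {T : Fin 3 → ℂ} (hT : T ≠ 0)
    (hTker : matA a ((k : ℂ) • a) k *ᵥ T = 0) {a' : Fin 3 → ℝ} {c' : ℝ} (haa : ∀ i, a i = a' i)
    (hcc : c = c') (h1 : ∃ i, a' i < c') (h2 : ∃ i, c' < a' i) : sqConst a c k s T ≠ 0 := by
  obtain ⟨p, hp, hp1, hp2⟩ := exists_pos_vec h1 h2
  set K : Fin 3 → ℂ := fun i => p i
  have hTi := apply_eq_of_matA_mulVec_eq_zero ha (by omega) hTker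
  have hT0 : T 0 ≠ 0 := fun h => hT (funext fun i => (hTi i).trans h)
  obtain ⟨v, hv⟩ := exists_real_vecH haa ha hk hTi (K := K) (fun i => rfl) le_rfl
  have hsq := sqH_of_sums (T := T) (K := K) (u := 1) ha hc hs hk hTker one_ne_zero
    (by simp only [K]; exact_mod_cast hp1)
    (by simp only [K, haa, hcc, mul_one]; exact_mod_cast hp2)
  rw [one_pow, one_mul] at hsq
  rw [← hsq]
  intro h0
  have h3 : sqH a k s T K = T 0 ^ 2 * ((∑ i, p i * v i ^ 2 : ℝ) : ℂ) := by
    push_cast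
    rw [sqH, Finset.mul_sum]
    refine Finset.sum_congr rfl fun i _ => ?_
    rw [hv]; ring
  rw [h3, mul_eq_zero, or_iff_right (pow_ne_zero _ hT0), Complex.ofReal_eq_zero,
    Finset.sum_eq_zero_iff_of_nonneg fun i _ => mul_nonneg (hp i).le (sq_nonneg _)] at h0
  -- All `v i` vanish; since every `K i` is nonzero, the recursion can be run backwards to `T = 0`.
  refine hT (eq_zero_of_vecH_eq_zero (K := K) ha hk
    (fun i => Complex.ofReal_ne_zero.2 (hp i).ne') le_rfl ?_)
  ext i
  have h4 := (mul_eq_zero.1 (h0 i (Finset.mem_univ i))).resolve_left (hp i).ne'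
  have h5 : v i = 0 := by simpa using h4
  simp [hv, h5]

/-! ### The polynomials `Q` and `q` -/

section
variable {a : Fin 3 → ℂ} {c : ℂ} {k s : ℕ} {T : Fin 3 → ℂ}

/-- The factor between `Q_{k,α}` and the numerator of `P_β² + P_γ²`. -/
def coefQ (a : Fin 3 → ℂ) (c : ℂ) (α : Fin 3) : ℂ := (∏ i, diffs a i) / (c - a α)

lemma coefQ_ne_zero (ha : Function.Injective a) (hc : ∀ i, c ≠ a i) (α : Fin 3) :
    coefQ a c α ≠ 0 :=
  div_ne_zero (Finset.prod_ne_zero_iff.2 fun i _ => diffs_ne_zero ha i) (sub_ne_zero.2 (hc α))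

lemma coefQ_mul_kap_add_one (ha : Function.Injective a) (hc : ∀ i, c ≠ a i) (α : Fin 3) :
    coefQ a c α * kap a c (α + 1) = (a (α + 2) - c) * (a α - a (α + 2)) := by
  have h1 := sub_ne_zero_of_injective ha (ne_add_one α).symm
  have h2 := sub_ne_zero_of_injective ha (add_one_ne_add_two α)
  have h3 := sub_ne_zero.2 (hc α)
  rw [coefQ, prod_fin_three_cyclic _ α, kap]
  simp only [diffs, fin3_add_one_add_one, fin3_add_one_add_two, fin3_add_two_add_one,
    fin3_add_two_add_two]
  field_simp
  ring

lemma coefQ_mul_kap_add_two (ha : Function.Injective a) (hc : ∀ i, c ≠ a i) (α : Fin 3) :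
    coefQ a c α * kap a c (α + 2) = (a (α + 1) - c) * (a (α + 1) - a α) := by
  have h1 := sub_ne_zero_of_injective ha (ne_add_two α).symm
  have h2 := sub_ne_zero_of_injective ha (add_one_ne_add_two α).symm
  have h3 := sub_ne_zero.2 (hc α)
  rw [coefQ, prod_fin_three_cyclic _ α, kap]
  simp only [diffs, fin3_add_one_add_one, fin3_add_one_add_two, fin3_add_two_add_one,
    fin3_add_two_add_two]
  field_simp
  ring

lemma polyQ_eq (ha : Function.Injective a) (hc : ∀ i, c ≠ a i) (α : Fin 3) :
    polyQ a c k s T α = C (coefQ a c α) *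
      (C (kap a c (α + 1)) * (X - C (a (α + 1))) * polyF a c k s T (α + 1) ^ 2 +
        C (kap a c (α + 2)) * (X - C (a (α + 2))) * polyF a c k s T (α + 2) ^ 2) := by
  rw [polyQ, ← coefQ_mul_kap_add_one ha hc, ← coefQ_mul_kap_add_two ha hc, C_mul, C_mul]
  ring

/-- At `λ = c` all `F_i` have the same nonzero value and `κ_i (c - a_i)` is a multiple of `d_i`;
since `d_β + d_γ = -d_α ≠ 0`, nothing cancels. -/
theorem polyQ_eval_c_ne_zero (ha : Function.Injective a) (hc : ∀ i, c ≠ a i)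
    (hk : k = 2 * s + 1) (hT : T ≠ 0) (hTker : matA a ((k : ℂ) • a) k *ᵥ T = 0) (α : Fin 3) :
    (polyQ a c k s T α).eval c ≠ 0 := by
  have hTi := apply_eq_of_matA_mulVec_eq_zero ha (by omega) hTker
  have hT0 : T 0 ≠ 0 := fun h => hT (funext fun i => (hTi i).trans h)
  obtain ⟨ρ, hρ, h⟩ := exists_vecH_diffs ha hk hTker le_rfl
  have hE := kapRatio_ne_zero ha hc
  have hF : ∀ i, (polyF a c k s T i).eval c = kapRatio a c ^ s * (ρ * T 0) := by
    intro i
    have : (fun i => kap a c i * (c - a i)) = kapRatio a c • diffs a := by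
      ext i; rw [kap_mul_sub ha]; rfl
    rw [polyF_eval, this, vecH_smul, Pi.smul_apply, smul_eq_mul, h]
  have hval : (polyQ a c k s T α).eval c =
      -(coefQ a c α * kapRatio a c * diffs a α * (kapRatio a c ^ s * (ρ * T 0)) ^ 2) := by
    rw [polyQ_eq ha hc]
    simp only [eval_mul, eval_add, eval_C, eval_sub, eval_X, eval_pow, hF, kap_mul_sub ha]
    simp only [diffs, fin3_add_one_add_one, fin3_add_one_add_two, fin3_add_two_add_one,
      fin3_add_two_add_two]
    ring
  rw [hval, neg_ne_zero]
  exact mul_ne_zero (mul_ne_zero (mul_ne_zero (coefQ_ne_zero ha hc α) hE) (diffs_ne_zero ha α))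
    (pow_ne_zero _ (mul_ne_zero (pow_ne_zero _ hE) (mul_ne_zero hρ hT0)))

/-- The polynomials `q_{s+1,α}`; here `w` is a square root of `Δ`. -/
def polyq (a : Fin 3 → ℂ) (c : ℂ) (k s : ℕ) (T : Fin 3 → ℂ) (w : ℂ) (α : Fin 3) : ℂ[X] :=
  C (Complex.I * k * w * coefQ a c α) *
    (C (a (α + 1) * kap a c (α + 1)) * (X - C (a (α + 1))) * polyF a c k s T (α + 1) +
      C (a (α + 2) * kap a c (α + 2)) * (X - C (a (α + 2))) * polyF a c k s T (α + 2))

lemma natDegree_polyq_le (w : ℂ) (α : Fin 3) : (polyq a c k s T w α).natDegree ≤ s + 1 := by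
  have h : ∀ (u : ℂ) (i : Fin 3), (C u * (X - C (a i)) * polyF a c k s T i).natDegree ≤ s + 1 := by
    intro u i
    refine natDegree_mul_le.trans ?_
    have h1 : (C u * (X - C (a i))).natDegree ≤ 1 :=
      (natDegree_C_mul_le _ _).trans (natDegree_X_sub_C_le _)
    have h2 := natDegree_polyF_le a k s T c i
    omega
  exact (natDegree_C_mul_le _ _).trans (natDegree_add_le_of_degree_le (h _ _) (h _ _))

/-- The point of the line `λ ↦ κ (λ - a) / (λ - c)`. -/
def lineK (a : Fin 3 → ℂ) (c x : ℂ) (i : Fin 3) : ℂ := kap a c i * ((x - a i) / (x - c))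

lemma polyQ_eval_of_ne (ha : Function.Injective a) (hc : ∀ i, c ≠ a i) (hk : k = 2 * s + 1)
    (α : Fin 3) {x : ℂ} (hx : x ≠ c) :
    (polyQ a c k s T α).eval x = coefQ a c α * (x - c) ^ k *
      (lineK a c x (α + 1) * vecH a k s T (lineK a c x) s (α + 1) ^ 2 +
        lineK a c x (α + 2) * vecH a k s T (lineK a c x) s (α + 2) ^ 2) := by
  have hx0 := sub_ne_zero.2 hx
  have h : ∀ i, kap a c i * (x - a i) = (x - c) * lineK a c x i := fun i => by
    rw [lineK]; field_simp
  rw [polyQ_eq ha hc]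
  simp only [eval_mul, eval_add, eval_C, eval_sub, eval_X, eval_pow, polyF_eval_of_ne hx, h]
  change coefQ a c α * (_ * ((x - c) ^ s * vecH a k s T (lineK a c x) s (α + 1)) ^ 2 +
    _ * ((x - c) ^ s * vecH a k s T (lineK a c x) s (α + 2)) ^ 2) = _
  rw [hk]
  ring

lemma polyq_eval_of_ne (w : ℂ) (α : Fin 3) {x : ℂ} (hx : x ≠ c) :
    (polyq a c k s T w α).eval x = Complex.I * k * w * coefQ a c α * (x - c) ^ (s + 1) *
      (a (α + 1) * lineK a c x (α + 1) * vecH a k s T (lineK a c x) s (α + 1) +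
        a (α + 2) * lineK a c x (α + 2) * vecH a k s T (lineK a c x) s (α + 2)) := by
  have hx0 := sub_ne_zero.2 hx
  have h : ∀ i, kap a c i * (x - a i) = (x - c) * lineK a c x i := fun i => by
    rw [lineK]; field_simp
  rw [polyq]
  simp only [eval_mul, eval_add, eval_C, eval_sub, eval_X, polyF_eval_of_ne hx, mul_assoc (a _), h]
  change Complex.I * k * w * coefQ a c α *
    (a (α + 1) * (_ * ((x - c) ^ s * vecH a k s T (lineK a c x) s (α + 1))) +
    a (α + 2) * (_ * ((x - c) ^ s * vecH a k s T (lineK a c x) s (α + 2)))) = _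
  ring

lemma hasDerivAt_lineK (ha : Function.Injective a) {x : ℂ} (hx : x ≠ c) (i : Fin 3) :
    HasDerivAt (fun x => lineK a c x i)
      (2 * (-(kapRatio a c * ((x - c) ^ 2)⁻¹) / 2) * diffs a i) x := by
  have hx0 := sub_ne_zero.2 hx
  have h1 : HasDerivAt (fun x => kap a c i + kapRatio a c * diffs a i * (x - c)⁻¹)
      (kapRatio a c * diffs a i * (-1 / (x - c) ^ 2)) x :=
    ((((hasDerivAt_id x).sub_const c).fun_inv hx0).const_mul _).const_add _
  have h2 := h1.congr_of_eventuallyEq (f₁ := fun x => lineK a c x i)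
    (eventually_of_mem (isOpen_ne.mem_nhds hx) fun y hy => kap_mul_div ha hy i)
  convert! h2 using 1
  ring

lemma sqH_lineK (ha : Function.Injective a) (hs : 1 ≤ s) (hk : k = 2 * s + 1)
    (hTker : matA a ((k : ℂ) • a) k *ᵥ T = 0) {x : ℂ} (hx : x ≠ c) :
    sqH a k s T (lineK a c x) = sqConst a c k s T := by
  rw [← sqH_line ha hs hk hTker (x - c)⁻¹]
  congr 1
  ext i
  exact kap_mul_div ha hx i

/-- The factor `(λ - c) ^ k` contributes nothing at a root. The derivatives of `K_β H_β ^ 2` and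
`K_γ H_γ ^ 2` come from the motion along the line, with `π = -kapRatio / (2 (λ - c) ^ 2)`; their
terms in `H_β H_γ` cancel. -/
lemma derivative_polyQ_eval (ha : Function.Injective a) (hc : ∀ i, c ≠ a i) (hs : 1 ≤ s)
    (hk : k = 2 * s + 1) (hTker : matA a ((k : ℂ) • a) k *ᵥ T = 0) (α : Fin 3) {r : ℂ}
    (hr : r ≠ c) (hQ : (polyQ a c k s T α).eval r = 0) :
    (derivative (polyQ a c k s T α)).eval r * (r - c) ^ 2 =
      coefQ a c α * (r - c) ^ k * kapRatio a c * k * vecH a k s T (lineK a c r) s α *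
        (vecH a k s T (lineK a c r) s (α + 1) * a (α + 2) -
          vecH a k s T (lineK a c r) s (α + 2) * a (α + 1)) := by
  have hr0 := sub_ne_zero.2 hr
  have hd := fun i => hasDerivAt_mul_vecH_sq ha hs hk hTker (hasDerivAt_lineK (c := c) ha hr) i
  have h1 := (((((hasDerivAt_id r).sub_const c).pow k).const_mul (coefQ a c α)).mul
    ((hd (α + 1)).add (hd (α + 2))))
  have h2 := h1.congr_of_eventuallyEq (f₁ := fun x => (polyQ a c k s T α).eval x)
    (eventually_of_mem (isOpen_ne.mem_nhds hr) fun y hy => polyQ_eval_of_ne ha hc hk α hy)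
  rw [((polyQ a c k s T α).hasDerivAt r).unique h2]
  have h0 : lineK a c r (α + 1) * vecH a k s T (lineK a c r) s (α + 1) ^ 2 +
      lineK a c r (α + 2) * vecH a k s T (lineK a c r) s (α + 2) ^ 2 = 0 := by
    rw [polyQ_eval_of_ne ha hc hk α hr] at hQ
    exact (mul_eq_zero.1 hQ).resolve_left
      (mul_ne_zero (coefQ_ne_zero ha hc α) (pow_ne_zero _ hr0))
  simp only [Pi.add_apply, h0, mul_zero, zero_add, fin3_add_one_add_one, fin3_add_one_add_two,
    fin3_add_two_add_one, fin3_add_two_add_two, Pi.pow_apply, id]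
  field_simp
  ring

lemma polyU_eval (ha : Function.Injective a) {x : ℂ} (hx : x ≠ c) :
    (polyU a c).eval x * kapRatio a c ^ 2 = (∏ i, lineK a c x i) * (x - c) ^ 4 := by
  have hx0 := sub_ne_zero.2 hx
  have h := prod_kap (c := c) ha
  simp only [Fin.prod_univ_three] at h
  simp only [polyU, eval_neg, eval_mul, eval_sub, eval_X, eval_C, Fin.prod_univ_three,
    lineK]
  field_simp
  linear_combination -((x - a 0) * (x - a 1) * (x - a 2)) * h

/-- At a zero `r` of `Q` the candidates for the residues of `q (λ - c)^s / (Q μ)` have square 1. -/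
theorem sq_residue (ha : Function.Injective a) (hc : ∀ i, c ≠ a i) (hs : 1 ≤ s)
    (hk : k = 2 * s + 1) (hTker : matA a ((k : ℂ) • a) k *ᵥ T = 0) (α : Fin 3) {w : ℂ}
    (hw : w ^ 2 = sqConst a c k s T) {r : ℂ} (hr : r ≠ c)
    (hQ : (polyQ a c k s T α).eval r = 0) :
    ((polyq a c k s T w α).eval r * (r - c) ^ s) ^ 2 =
      (derivative (polyQ a c k s T α)).eval r ^ 2 * (polyU a c).eval r := by
  have hr0 := sub_ne_zero.2 hr
  have hE := kapRatio_ne_zero ha hc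
  have hd := derivative_polyQ_eval ha hc hs hk hTker α hr hQ
  have hU := polyU_eval ha hr
  have hq := polyq_eval_of_ne (a := a) (k := k) (s := s) (T := T) w α hr
  have hΔ := sqH_lineK ha hs hk hTker hr
  have h0 : lineK a c r (α + 1) * vecH a k s T (lineK a c r) s (α + 1) ^ 2 +
      lineK a c r (α + 2) * vecH a k s T (lineK a c r) s (α + 2) ^ 2 = 0 := by
    rw [polyQ_eval_of_ne ha hc hk α hr] at hQ
    exact (mul_eq_zero.1 hQ).resolve_left
      (mul_ne_zero (coefQ_ne_zero ha hc α) (pow_ne_zero _ hr0))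
  rw [sqH, sum_fin_three_cyclic _ α, ← hw] at hΔ
  rw [prod_fin_three_cyclic _ α] at hU
  have hkc : (r - c) ^ k = (r - c) ^ (2 * s + 1) := by rw [hk]
  rw [hkc] at hd
  generalize vecH a k s T (lineK a c r) s α = Hα at *
  generalize vecH a k s T (lineK a c r) s (α + 1) = Hβ at *
  generalize vecH a k s T (lineK a c r) s (α + 2) = Hγ at *
  generalize lineK a c r α = Kα at *
  generalize lineK a c r (α + 1) = Kβ at *
  generalize lineK a c r (α + 2) = Kγ at *
  generalize (polyU a c).eval r = U at *
  generalize (derivative (polyQ a c k s T α)).eval r = Q' at *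
  generalize coefQ a c α = Cq at *
  generalize kapRatio a c = E at *
  generalize a (α + 1) = aβ at *
  generalize a (α + 2) = aγ at *
  -- At a root of `Q` the whole integral `Δ` is carried by the component `α`.
  have hw2 : w ^ 2 = Kα * Hα ^ 2 := by linear_combination -hΔ + h0
  -- Lagrange's identity for the form with weights `K_β, K_γ`, on which `(H_β, H_γ)` is isotropic by
  -- `h0`.
  have hid : (aβ * Kβ * Hβ + aγ * Kγ * Hγ) ^ 2 = -(Kβ * Kγ * (Hβ * aγ - Hγ * aβ) ^ 2) := by
    linear_combination (aβ ^ 2 * Kβ + aγ ^ 2 * Kγ) * h0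
  have hlhs : ((polyq a c k s T w α).eval r * (r - c) ^ s) ^ 2 =
      (k * Cq * (r - c) ^ (2 * s + 1) * Hα * (Hβ * aγ - Hγ * aβ)) ^ 2 * (Kα * Kβ * Kγ) := by
    rw [hq]
    calc _ = Complex.I ^ 2 * (k * Cq * (r - c) ^ (2 * s + 1)) ^ 2 * w ^ 2 *
          (aβ * Kβ * Hβ + aγ * Kγ * Hγ) ^ 2 := by ring
      _ = _ := by rw [hid, hw2, Complex.I_sq]; ring
  have hne : (r - c) ^ 4 * E ^ 2 ≠ 0 := mul_ne_zero (pow_ne_zero _ hr0) (pow_ne_zero _ hE)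
  refine mul_right_cancel₀ hne ?_
  rw [hlhs]
  calc _ = (Cq * (r - c) ^ (2 * s + 1) * E * k * Hα * (Hβ * aγ - Hγ * aβ)) ^ 2 *
        (Kα * Kβ * Kγ * (r - c) ^ 4) := by ring
    _ = (Q' * (r - c) ^ 2) ^ 2 * (U * E ^ 2) := by rw [hd, hU]
    _ = _ := by ring

end

/-! ### Local behaviour of the differentials -/

lemma analyticAt_eval {f : ℂ → ℂ} {z : ℂ} (hf : AnalyticAt ℂ f z) (p : ℂ[X]) :
    AnalyticAt ℂ (fun t => p.eval (f t)) z := by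
  simpa using hf.aeval_polynomial p

lemma analyticAt_dslope {f : ℂ → ℂ} {z : ℂ} (hf : AnalyticAt ℂ f z) :
    AnalyticAt ℂ (dslope f z) z := by
  obtain ⟨p, hp⟩ := hf
  exact ⟨_, hp.has_fpower_series_dslope_fslope⟩

lemma SimplePart.of_eq_div {f φ : ℂ → ℂ} (hφ : AnalyticAt ℂ φ 0)
    (h : ∀ᶠ τ in 𝓝[≠] (0 : ℂ), f τ = φ τ / τ) : SimplePart f (φ 0) := by
  refine ⟨dslope φ 0, analyticAt_dslope hφ, ?_⟩
  filter_upwards [h, self_mem_nhdsWithin] with τ h1 h2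
  have h2' : τ ≠ 0 := h2
  rw [h1, dslope_of_ne _ h2', slope_def_field, sub_zero]
  field_simp
  ring

lemma SimplePart.of_analyticAt {f g : ℂ → ℂ} (hg : AnalyticAt ℂ g 0)
    (h : ∀ᶠ τ in 𝓝[≠] (0 : ℂ), f τ = g τ) : SimplePart f 0 :=
  ⟨g, hg, by simpa using h⟩

lemma SimplePart.unique {f : ℂ → ℂ} {ρ ρ' : ℂ} (h : SimplePart f ρ) (h' : SimplePart f ρ') :
    ρ = ρ' := by
  have key : ∀ {ρ : ℂ}, SimplePart f ρ → Tendsto (fun τ => τ * f τ) (𝓝[≠] 0) (𝓝 ρ) := by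
    rintro ρ ⟨g, hg, h⟩
    have h1 : Tendsto (fun τ => ρ + τ * g τ) (𝓝 0) (𝓝 (ρ + 0 * g 0)) :=
      (continuousAt_const.add (continuousAt_id.mul hg.continuousAt)).tendsto
    rw [zero_mul, add_zero] at h1
    refine (h1.mono_left nhdsWithin_le_nhds).congr' ?_
    filter_upwards [h, self_mem_nhdsWithin] with τ h1 h2
    have h2' : τ ≠ 0 := h2
    rw [h1]
    field_simp
  exact tendsto_nhds_unique (key h) (key h')

namespace IsLocalParam

variable {p : ℂ[X]} {x₀ y₀ : ℂ} {x y : ℂ → ℂ}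

lemma two_mul_deriv (h : IsLocalParam p x₀ y₀ x y) :
    ∀ᶠ τ in 𝓝 0, 2 * y τ * deriv y τ = (derivative p).eval (x τ) * deriv x τ := by
  filter_upwards [h.analytic_x.eventually_analyticAt, h.analytic_y.eventually_analyticAt,
    h.curve.eventually_nhds] with τ hx hy hc
  have h1 := hy.differentiableAt.hasDerivAt.fun_pow 2
  have h2 := ((p.hasDerivAt (x τ)).comp τ hx.differentiableAt.hasDerivAt)
  have h3 := h1.unique (h2.congr_of_eventuallyEq hc)
  simpa using h3

lemma deriv_x_ne_zero (h : IsLocalParam p x₀ y₀ x y) (hy₀ : y₀ ≠ 0) : deriv x 0 ≠ 0 := by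
  intro h0
  have h1 := h.two_mul_deriv.self_of_nhds
  rw [h0, mul_zero, h.y_zero, mul_eq_zero, or_iff_right (mul_ne_zero two_ne_zero hy₀)] at h1
  exact h.immersed.elim (fun h => h h0) (fun h => h h1)

lemma deriv_y_ne_zero (h : IsLocalParam p x₀ y₀ x y) (hp : (derivative p).eval x₀ ≠ 0)
    (hy₀ : y₀ = 0) : deriv y 0 ≠ 0 := by
  have h1 := h.two_mul_deriv.self_of_nhds
  rw [h.y_zero, hy₀, mul_zero, zero_mul, h.x_zero, eq_comm, mul_eq_zero, or_iff_right hp] at h1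
  exact h.immersed.resolve_left fun h => h h1

end IsLocalParam

variable {a : Fin 3 → ℂ} {c : ℂ}

/-- With `Q = (X - r) Q₁` and `x - r = τ g`, the factor `x'(0) = g(0)` cancels, so the residue does
not depend on the parameter. -/
lemma finitePart_of_root {s : ℕ} {q Q : ℂ[X]} {r y₀ : ℂ} (hy₀ : y₀ ≠ 0) (hr : Q.eval r = 0)
    (hr' : (derivative Q).eval r ≠ 0) :
    FinitePart a c (diffW c s q Q) r y₀
      (q.eval r * (r - c) ^ s / ((derivative Q).eval r * y₀)) := by
  intro x y h
  obtain ⟨Q₁, rfl⟩ := dvd_iff_isRoot.2 hr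
  have hd : (derivative ((X - C r) * Q₁)).eval r = Q₁.eval r := by
    simp [derivative_mul]
  rw [hd] at hr' ⊢
  have hx' := h.deriv_x_ne_zero hy₀
  set g := dslope x 0
  have hg : AnalyticAt ℂ g 0 := analyticAt_dslope h.analytic_x
  have hg0 : g 0 = deriv x 0 := dslope_same _ _
  set φ : ℂ → ℂ := fun τ =>
    q.eval (x τ) * (x τ - c) ^ s * deriv x τ / (g τ * Q₁.eval (x τ) * y τ)
  have hφ : AnalyticAt ℂ φ 0 := by
    refine AnalyticAt.fun_div (((analyticAt_eval h.analytic_x q).fun_mul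
      ((h.analytic_x.fun_sub analyticAt_const).fun_pow s)).fun_mul h.analytic_x.deriv)
      ((hg.fun_mul (analyticAt_eval h.analytic_x Q₁)).fun_mul h.analytic_y) ?_
    rw [hg0, h.x_zero, h.y_zero]
    exact mul_ne_zero (mul_ne_zero hx' hr') hy₀
  have hφ0 : φ 0 = q.eval r * (r - c) ^ s / (Q₁.eval r * y₀) := by
    simp only [φ, hg0, h.x_zero, h.y_zero]
    field_simp
  rw [← hφ0]
  refine SimplePart.of_eq_div hφ ?_
  filter_upwards [self_mem_nhdsWithin] with τ h2
  have h2' : τ ≠ 0 := h2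
  have h3 : x τ - r = g τ * τ := by
    simp only [g]
    rw [dslope_of_ne _ h2', slope_def_field, h.x_zero, sub_zero, div_mul_cancel₀ _ h2']
  simp only [diffW, φ, eval_mul, eval_sub, eval_X, eval_C, h3]
  rw [div_mul_eq_mul_div, div_div]
  congr 1
  ring

lemma derivative_polyU_ne_zero (ha : Function.Injective a) (hc : ∀ i, c ≠ a i) {x : ℂ}
    (hx : (polyU a c).eval x = 0) : (derivative (polyU a c)).eval x ≠ 0 := by
  have h01 := sub_ne_zero_of_injective ha (by decide : (0 : Fin 3) ≠ 1)
  have h02 := sub_ne_zero_of_injective ha (by decide : (0 : Fin 3) ≠ 2)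
  have h12 := sub_ne_zero_of_injective ha (by decide : (1 : Fin 3) ≠ 2)
  have h10 := sub_ne_zero_of_injective ha (by decide : (1 : Fin 3) ≠ 0)
  have h20 := sub_ne_zero_of_injective ha (by decide : (2 : Fin 3) ≠ 0)
  have h21 := sub_ne_zero_of_injective ha (by decide : (2 : Fin 3) ≠ 1)
  have hc' := fun i => sub_ne_zero.2 (hc i)
  have hc'' := fun i => sub_ne_zero.2 (hc i).symm
  have hd : (derivative (polyU a c)).eval x = -((x - a 1) * (x - a 2) * (x - c) +
      (x - a 0) * (x - a 2) * (x - c) + (x - a 0) * (x - a 1) * (x - c) +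
      (x - a 0) * (x - a 1) * (x - a 2)) := by
    simp [polyU, Fin.prod_univ_three, derivative_mul]
    ring
  rw [hd]
  simp only [polyU, Fin.prod_univ_three, eval_neg, eval_mul, eval_sub, eval_X, eval_C,
    neg_eq_zero, mul_eq_zero, sub_eq_zero] at hx
  rcases hx with ((rfl | rfl) | rfl) | rfl <;> simp [*]

lemma finitePart_of_ne_zero (ha : Function.Injective a) (hc : ∀ i, c ≠ a i) {s : ℕ} {q Q : ℂ[X]}
    {x₀ y₀ : ℂ} (hy₀ : y₀ ^ 2 = (polyU a c).eval x₀) (hQ : Q.eval x₀ ≠ 0) :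
    FinitePart a c (diffW c s q Q) x₀ y₀ 0 := by
  intro x y h
  have hnum : AnalyticAt ℂ (fun τ => q.eval (x τ) * (x τ - c) ^ s) 0 :=
    (analyticAt_eval h.analytic_x q).fun_mul ((h.analytic_x.fun_sub analyticAt_const).fun_pow s)
  by_cases hy : y₀ = 0
  · have hU' : (derivative (polyU a c)).eval x₀ ≠ 0 :=
      derivative_polyU_ne_zero ha hc (by rw [← hy₀, hy]; ring)
    -- At a branch point `μ` is the local coordinate, and `dλ / μ = 2 dμ / U_4'(λ)` is regular since
    -- the roots of `U_4` are simple.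
    refine SimplePart.of_analyticAt (g := fun τ => q.eval (x τ) * (x τ - c) ^ s *
      (2 * deriv y τ) / (Q.eval (x τ) * (derivative (polyU a c)).eval (x τ))) ?_ ?_
    · refine (hnum.fun_mul (analyticAt_const.fun_mul h.analytic_y.deriv)).fun_div
        ((analyticAt_eval h.analytic_x Q).fun_mul (analyticAt_eval h.analytic_x _)) ?_
      rw [h.x_zero]
      exact mul_ne_zero hQ hU'
    · have hyne := (h.analytic_y.differentiableAt.hasDerivAt.eventually_ne
        (c := 0) (h.deriv_y_ne_zero hU' hy))
      have hUne : ∀ᶠ τ in 𝓝[≠] (0 : ℂ), (derivative (polyU a c)).eval (x τ) ≠ 0 :=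
        nhdsWithin_le_nhds ((analyticAt_eval h.analytic_x _).continuousAt.eventually_ne
          (by rwa [h.x_zero]))
      have hQne : ∀ᶠ τ in 𝓝[≠] (0 : ℂ), Q.eval (x τ) ≠ 0 :=
        nhdsWithin_le_nhds ((analyticAt_eval h.analytic_x _).continuousAt.eventually_ne
          (by rwa [h.x_zero]))
      filter_upwards [hyne, hUne, hQne, nhdsWithin_le_nhds h.two_mul_deriv] with τ h1 h2 h3 h4
      rw [diffW]
      field_simp
      linear_combination -(q.eval (x τ) * (x τ - c) ^ s) * h4
  · refine SimplePart.of_analyticAt (g := fun τ => diffW c s q Q (x τ) (y τ) * deriv x τ) ?_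
      (Eventually.of_forall fun _ => rfl)
    refine AnalyticAt.fun_mul (hnum.fun_div ((analyticAt_eval h.analytic_x Q).fun_mul
      h.analytic_y) ?_) h.analytic_x.deriv
    rw [h.x_zero, h.y_zero]
    exact mul_ne_zero hQ hy

lemma eval_inv_mul_pow {p : ℂ[X]} {N : ℕ} (hp : p.natDegree ≤ N) {x : ℂ} (hx : x ≠ 0) :
    p.eval x⁻¹ * x ^ N = (reflect N p).eval x := by
  let _ : Invertible x⁻¹ := invertibleOfNonzero (inv_ne_zero hx)
  have h := eval₂_reflect_mul_pow (RingHom.id ℂ) x⁻¹ N p hp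
  rw [invOf_eq_inv, inv_inv] at h
  change (reflect N p).eval x * _ = p.eval x⁻¹ at h
  rw [← h, mul_assoc, ← mul_pow, inv_mul_cancel₀ hx, one_pow, mul_one]

/-- With `λ = 1 / ξ` and `μ = η / ξ ^ 2` all powers of `ξ` cancel, because `(s + 1) + s = k` and `dλ
= -dξ / ξ ^ 2`. The remaining denominator is nonzero at `ξ = 0`: `η₀ ^ 2 = -1` and `Q` has exact
degree `k`. -/
lemma infinitePart {k s : ℕ} (hk : k = 2 * s + 1) {q Q : ℂ[X]} (hq : q.natDegree ≤ s + 1)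
    (hQ : Q.natDegree ≤ k) (hQk : Q.coeff k ≠ 0) {η₀ : ℂ} (hη₀ : η₀ ^ 2 = (polyV a c).eval 0) :
    InfinitePart a c (diffW c s q Q) η₀ 0 := by
  intro ξ η h
  have hη : η₀ ≠ 0 := by
    rintro rfl
    simp [polyV, eval_prod] at hη₀
  have hQ0 : (reflect k Q).eval 0 ≠ 0 := by
    rw [← coeff_zero_eq_eval_zero, coeff_reflect, revAt_le (Nat.zero_le k), Nat.sub_zero]
    exact hQk
  refine SimplePart.of_analyticAt (g := fun τ => -((reflect (s + 1) q).eval (ξ τ) *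
    (1 - c * ξ τ) ^ s * deriv ξ τ / ((reflect k Q).eval (ξ τ) * η τ))) ?_ ?_
  · refine (AnalyticAt.fun_div (((analyticAt_eval h.analytic_x _).fun_mul
      ((analyticAt_const.fun_sub (analyticAt_const.fun_mul h.analytic_x)).fun_pow s)).fun_mul
        h.analytic_x.deriv)
      ((analyticAt_eval h.analytic_x _).fun_mul h.analytic_y) ?_).fun_neg
    rw [h.x_zero, h.y_zero]
    exact mul_ne_zero hQ0 hη
  · have hξ := h.analytic_x.differentiableAt.hasDerivAt.eventually_ne
      (c := 0) (h.deriv_x_ne_zero hη)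
    filter_upwards [hξ, nhdsWithin_le_nhds h.analytic_x.eventually_analyticAt] with τ h1 h2
    rw [(h2.differentiableAt.hasDerivAt.fun_inv h1).deriv, ← eval_inv_mul_pow hq h1,
      ← eval_inv_mul_pow hQ h1, diffW]
    have h3 : ((ξ τ)⁻¹ - c) ^ s = (1 - c * ξ τ) ^ s * ((ξ τ) ^ s)⁻¹ := by
      rw [← inv_pow, ← mul_pow]
      congr 1
      field_simp
    rw [h3, hk]
    by_cases hQx : Q.eval (ξ τ)⁻¹ = 0
    · simp [hQx]
    by_cases hηx : η τ = 0
    · simp [hηx]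
    field_simp
    ring

/-- Residue conditions quantify over all local parameters; a parameter must exist before residues
can be compared. -/
lemma exists_isLocalParam {p : ℂ[X]} {x₀ y₀ : ℂ} (hy₀ : y₀ ≠ 0) (h : y₀ ^ 2 = p.eval x₀) :
    ∃ x y : ℂ → ℂ, IsLocalParam p x₀ y₀ x y := by
  have hx : AnalyticAt ℂ (fun τ : ℂ => x₀ + τ) 0 := analyticAt_const.fun_add analyticAt_id
  have hp : AnalyticAt ℂ (fun τ : ℂ => p.eval (x₀ + τ) / y₀ ^ 2) 0 :=
    (analyticAt_eval hx p).fun_div analyticAt_const (pow_ne_zero 2 hy₀)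
  have hp0 : p.eval (x₀ + 0) / y₀ ^ 2 = 1 := by
    rw [add_zero, ← h, div_self (pow_ne_zero 2 hy₀)]
  have hlog : AnalyticAt ℂ (fun τ : ℂ => Complex.log (p.eval (x₀ + τ) / y₀ ^ 2)) 0 :=
    hp.clog (by rw [hp0]; exact Complex.one_mem_slitPlane)
  refine ⟨fun τ => x₀ + τ,
    fun τ => y₀ * Complex.exp (1 / 2 * Complex.log (p.eval (x₀ + τ) / y₀ ^ 2)), hx,
    analyticAt_const.fun_mul (analyticAt_const.fun_mul hlog).cexp, add_zero _, ?_, ?_, Or.inl ?_⟩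
  · simp only [hp0, Complex.log_one, mul_zero, Complex.exp_zero, mul_one]
  · have hne : ∀ᶠ τ in 𝓝 (0 : ℂ), p.eval (x₀ + τ) / y₀ ^ 2 ≠ 0 :=
      hp.continuousAt.eventually_ne (by rw [hp0]; exact one_ne_zero)
    filter_upwards [hne] with τ hτ
    rw [mul_pow, ← Complex.exp_nat_mul, Nat.cast_two, ← mul_assoc, mul_one_div_cancel two_ne_zero,
      one_mul, Complex.exp_log hτ, mul_div_cancel₀ _ (pow_ne_zero 2 hy₀)]
  · simp

lemma FinitePart.unique {w : ℂ → ℂ → ℂ} {x₀ y₀ ρ ρ' : ℂ} (hy₀ : y₀ ≠ 0)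
    (hU : y₀ ^ 2 = (polyU a c).eval x₀) (h : FinitePart a c w x₀ y₀ ρ)
    (h' : FinitePart a c w x₀ y₀ ρ') : ρ = ρ' := by
  obtain ⟨x, y, hxy⟩ := exists_isLocalParam hy₀ hU
  exact (h x y hxy).unique (h' x y hxy)

/-! ### Polynomials given by their roots. -/

section
variable {k : ℕ} {r₀ : ℂ} {r : Fin k → ℂ}

lemma eval_root_prod (i : Fin k) : (C r₀ * ∏ i, (X - C (r i))).eval (r i) = 0 := by
  rw [eval_mul, eval_prod, Finset.prod_eq_zero (Finset.mem_univ i) (by simp), mul_zero]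

lemma derivative_eval_root_prod_ne_zero (hr₀ : r₀ ≠ 0) (hr : Function.Injective r) (i : Fin k) :
    (derivative (C r₀ * ∏ i, (X - C (r i)))).eval (r i) ≠ 0 := by
  classical
  rw [← Finset.mul_prod_erase Finset.univ _ (Finset.mem_univ i), mul_left_comm]
  simp only [derivative_mul, derivative_X_sub_C, one_mul, eval_add, eval_mul, eval_sub, eval_X,
    eval_C, sub_self, zero_mul, add_zero, eval_prod]
  refine mul_ne_zero hr₀ (Finset.prod_ne_zero_iff.2 fun j hj => sub_ne_zero.2 ?_)
  exact hr.ne (Finset.ne_of_mem_erase hj).symm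

lemma natDegree_root_prod (hr₀ : r₀ ≠ 0) : (C r₀ * ∏ i, (X - C (r i))).natDegree = k := by
  rw [natDegree_C_mul hr₀, natDegree_prod_of_monic _ _ fun i _ => monic_X_sub_C _]
  simp

end

/-- The differentials `W` for a polynomial `Q` with simple roots. -/
theorem residues_diffW (ha : Function.Injective a) (hc : ∀ i, c ≠ a i) {k s : ℕ} (hs : 1 ≤ s)
    (hk : k = 2 * s + 1) {q Q : ℂ[X]} (hq : q.natDegree ≤ s + 1) (hQc : Q.eval c ≠ 0)
    (hres : ∀ x, x ≠ c → Q.eval x = 0 → (q.eval x * (x - c) ^ s) ^ 2 =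
      (derivative Q).eval x ^ 2 * (polyU a c).eval x)
    {r₀ : ℂ} {r : Fin k → ℂ} (hr₀ : r₀ ≠ 0) (hr : Function.Injective r)
    (hQ : Q = C r₀ * ∏ i, (X - C (r i))) (hra : ∀ i j, r i ≠ a j) :
    ∃ ν : Fin k → ℂ, (∀ i, ν i ^ 2 = (polyU a c).eval (r i)) ∧ (∀ i, ν i ≠ 0) ∧
      (∀ i, FinitePart a c (diffW c s q Q) (r i) (ν i) 1 ∧
        FinitePart a c (diffW c s q Q) (r i) (-ν i) (-1)) ∧
      (∀ x₀ y₀ : ℂ, y₀ ^ 2 = (polyU a c).eval x₀ → (∀ i, x₀ ≠ r i) →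
        FinitePart a c (diffW c s q Q) x₀ y₀ 0) ∧
      (∀ η₀ : ℂ, η₀ ^ 2 = (polyV a c).eval 0 → InfinitePart a c (diffW c s q Q) η₀ 0) ∧
      ∀ q' : ℂ[X], q'.natDegree ≤ s + 1 →
        (∀ i, FinitePart a c (diffW c s q' Q) (r i) (ν i) 1 ∧
          FinitePart a c (diffW c s q' Q) (r i) (-ν i) (-1)) → q' = q := by
  have hroot : ∀ i, Q.eval (r i) = 0 := fun i => by rw [hQ, eval_root_prod]
  have hroot' : ∀ i, (derivative Q).eval (r i) ≠ 0 := fun i => by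
    rw [hQ]; exact derivative_eval_root_prod_ne_zero hr₀ hr i
  have hrc : ∀ i, r i ≠ c := fun i h => hQc (h ▸ hroot i)
  have hrc' : ∀ i, r i - c ≠ 0 := fun i => sub_ne_zero.2 (hrc i)
  have hU : ∀ i, (polyU a c).eval (r i) ≠ 0 := by
    intro i
    simp only [polyU, eval_neg, eval_mul, eval_prod, eval_sub, eval_X, eval_C]
    exact neg_ne_zero.2 (mul_ne_zero (Finset.prod_ne_zero_iff.2 fun j _ =>
      sub_ne_zero.2 (hra i j)) (hrc' i))
  -- The sign of the square root is chosen so that the residue is 1; `hres` says that this value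
  -- does square to `U_4`.
  set ν : Fin k → ℂ := fun i => q.eval (r i) * (r i - c) ^ s / (derivative Q).eval (r i) with hν
  have hν2 : ∀ i, ν i ^ 2 = (polyU a c).eval (r i) := fun i => by
    rw [hν, div_pow, hres _ (hrc i) (hroot i), mul_div_cancel_left₀ _ (pow_ne_zero 2 (hroot' i))]
  have hν0 : ∀ i, ν i ≠ 0 := fun i h => hU i (by rw [← hν2, h]; ring)
  have hmul : ∀ i, q.eval (r i) * (r i - c) ^ s = (derivative Q).eval (r i) * ν i := fun i => by
    rw [hν, mul_div_cancel₀ _ (hroot' i)]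
  refine ⟨ν, hν2, hν0, fun i => ⟨?_, ?_⟩, fun x₀ y₀ h0 hx₀ => ?_, fun η₀ hη₀ => ?_,
    fun q' hq' h => ?_⟩
  · have h := finitePart_of_root (a := a) (c := c) (s := s) (q := q) (hν0 i) (hroot i) (hroot' i)
    rwa [hmul, div_self (mul_ne_zero (hroot' i) (hν0 i))] at h
  · have h := finitePart_of_root (a := a) (c := c) (s := s) (q := q) (neg_ne_zero.2 (hν0 i))
      (hroot i) (hroot' i)
    rwa [hmul, mul_neg, div_neg, div_self (mul_ne_zero (hroot' i) (hν0 i))] at h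
  · refine finitePart_of_ne_zero ha hc h0 ?_
    rw [hQ, eval_mul, eval_prod, eval_C]
    exact mul_ne_zero hr₀ (Finset.prod_ne_zero_iff.2 fun i _ => by
      simpa [sub_eq_zero] using hx₀ i)
  · have hdeg : Q.natDegree = k := by rw [hQ, natDegree_root_prod hr₀]
    refine infinitePart hk hq hdeg.le ?_ hη₀
    have hQ0 : Q ≠ 0 := fun h => hQc (by simp [h])
    have := leadingCoeff_ne_zero.2 hQ0
    rwa [leadingCoeff, hdeg] at this
  · have heq : ∀ i, q'.eval (r i) = q.eval (r i) := fun i => by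
      have h1 := (h i).1.unique (hν0 i) (hν2 i)
        (finitePart_of_root (hν0 i) (hroot i) (hroot' i))
      rw [eq_div_iff (mul_ne_zero (hroot' i) (hν0 i)), one_mul, ← hmul] at h1
      exact (mul_right_cancel₀ (pow_ne_zero s (hrc' i)) h1).symm
    rw [← sub_eq_zero]
    by_contra hne
    -- A nonzero difference of degree at most `s + 1` would have `2 s + 1` roots, impossible for `s
    -- ≥ 1`.
    have hcard := card_le_degree_of_subset_roots (p := q' - q) (Z := Finset.univ.image r) (by
      intro x hx
      obtain ⟨i, -, rfl⟩ := Finset.mem_image.1 (Finset.mem_def.2 hx)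
      rw [mem_roots hne, IsRoot, eval_sub, heq, sub_self])
    rw [Finset.card_image_of_injective _ hr, Finset.card_univ, Fintype.card_fin] at hcard
    have := natDegree_sub_le_of_le hq' hq
    simp only [max_self] at this
    omega

/-! ### Solutions of the Poisson equations -/

section
variable {a : Fin 3 → ℂ} {k : ℕ} {M : ℂ → Fin 3 → ℂ} {D : Set ℂ} {g h : ℂ → Fin 3 → ℂ}

lemma isPoissonSolution_iff : IsPoissonSolution a k M D g ↔ ∀ t ∈ D, ∀ i,
    HasDerivAt (fun t => g t i) (k * (g t (i + 1) * (a (i + 2) * M t (i + 2)) -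
      g t (i + 2) * (a (i + 1) * M t (i + 1)))) t := by
  refine forall₂_congr fun t _ => ?_
  rw [hasDerivAt_pi]
  refine forall_congr' fun i => ?_
  rw [Pi.smul_apply, cross_apply', smul_eq_mul, Pi.mul_apply, Pi.mul_apply]

lemma IsPoissonSolution.add (hg : IsPoissonSolution a k M D g) (hh : IsPoissonSolution a k M D h) :
    IsPoissonSolution a k M D (fun t => g t + h t) := by
  intro t ht
  convert! (hg t ht).add (hh t ht) using 1
  rw [map_add, LinearMap.add_apply, smul_add]

lemma IsPoissonSolution.smul (hg : IsPoissonSolution a k M D g) (u : ℂ) :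
    IsPoissonSolution a k M D (fun t => u • g t) := by
  intro t ht
  convert! (hg t ht).const_smul u using 1
  rw [map_smul, LinearMap.smul_apply, smul_comm]

lemma IsPoissonSolution.cross (hg : IsPoissonSolution a k M D g)
    (hh : IsPoissonSolution a k M D h) : IsPoissonSolution a k M D (fun t => g t ⨯₃ h t) := by
  rw [isPoissonSolution_iff] at *
  intro t ht i
  simp only [cross_apply']
  convert! ((hg t ht (i + 1)).mul (hh t ht (i + 2))).sub
    ((hg t ht (i + 2)).mul (hh t ht (i + 1))) using 1
  simp only [fin3_add_one_add_one, fin3_add_one_add_two, fin3_add_two_add_one,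
    fin3_add_two_add_two]
  ring

/-- The operator `g ↦ k g × aM` is skew for the complex bilinear form. -/
lemma IsPoissonSolution.dot_eq (hD : IsOpen D) (hD' : IsPreconnected D)
    (hg : IsPoissonSolution a k M D g) (hh : IsPoissonSolution a k M D h) {t t' : ℂ}
    (ht : t ∈ D) (ht' : t' ∈ D) : g t ⬝ᵥ h t = g t' ⬝ᵥ h t' := by
  rw [isPoissonSolution_iff] at *
  have hd : ∀ t ∈ D, HasDerivAt (fun t => g t ⬝ᵥ h t) 0 t := by
    intro t ht
    simp only [dotProduct]
    have := HasDerivAt.fun_sum (u := Finset.univ) fun i _ => (hg t ht i).mul (hh t ht i)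
    convert! this using 1
    rw [sum_fin_three_cyclic _ 0]
    simp only [fin3_01, fin3_02, fin3_11, fin3_12, fin3_21, fin3_22]
    ring
  exact hD.is_const_of_deriv_eq_zero hD'
    (fun t ht => (hd t ht).differentiableAt.differentiableWithinAt) (fun t ht => (hd t ht).deriv)
    ht ht'

lemma exists_isPoissonSolution (hD : IsOpen D) (hsc : IsSimplyConnected D)
    (hM : DifferentiableOn ℂ M D) {t₀ : ℂ} (ht₀ : t₀ ∈ D) (v : Fin 3 → ℂ) :
    ∃ g, IsPoissonSolution a k M D g ∧ g t₀ = v := by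
  let L : (Fin 3 → ℂ) →L[ℂ] ((Fin 3 → ℂ) →L[ℂ] (Fin 3 → ℂ)) :=
    LinearMap.toContinuousLinearMap
      ((LinearMap.toContinuousLinearMap :
        ((Fin 3 → ℂ) →ₗ[ℂ] (Fin 3 → ℂ)) ≃ₗ[ℂ] _).toLinearMap ∘ₗ (crossProduct (R := ℂ)).flip)
  have hL : ∀ u v, L u v = v ⨯₃ u := fun u v => rfl
  have hA : DifferentiableOn ℂ (fun t => (k : ℂ) • L (a * M t)) D := by
    have : DifferentiableOn ℂ (fun t => a * M t) D := (differentiableOn_const a).mul hM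
    exact (L.differentiable.comp_differentiableOn this).const_smul (k : ℂ)
  obtain ⟨Φ, h1, h2⟩ := exists_fundamental_solution hD hsc hA ht₀
  refine ⟨fun t => Φ t v, fun t ht => ?_, by simp [h1]⟩
  have h3 := (h2 t ht).clm_apply (hasDerivAt_const t v)
  convert! h3 using 1
  simp [hL]

/-- Uniqueness by duality: pair `g` with the solution equal to a basis vector at `t`; the pairing is
constant and vanishes at `t₀`. -/
lemma IsPoissonSolution.eq_zero (hD : IsOpen D) (hsc : IsSimplyConnected D)
    (hM : DifferentiableOn ℂ M D) (hg : IsPoissonSolution a k M D g) {t₀ : ℂ} (ht₀ : t₀ ∈ D)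
    (h0 : g t₀ = 0) {t : ℂ} (ht : t ∈ D) : g t = 0 := by
  ext i
  obtain ⟨h, hh, hht⟩ := exists_isPoissonSolution (a := a) (k := k) hD hsc hM ht (Pi.single i 1)
  have := hg.dot_eq hD hsc.isPathConnected.isConnected.isPreconnected hh ht ht₀
  rwa [h0, zero_dotProduct, hht, dotProduct_single, mul_one] at this

/-- Over `ℂ` orthogonal vectors may be isotropic. Among the sums of two squares of coordinates of
`e` one is nonzero, as together they give `2 e·e = 2`; it can be normalized to yield `x` in that
coordinate plane. Then `y = e × x`. -/
lemma exists_orthonormal_pair {e : Fin 3 → ℂ} (he : e ⬝ᵥ e = 1) :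
    ∃ x y : Fin 3 → ℂ, x ⬝ᵥ x = 1 ∧ y ⬝ᵥ y = 1 ∧ x ⬝ᵥ y = 0 ∧ x ⬝ᵥ e = 0 ∧ y ⬝ᵥ e = 0 ∧
      x ⨯₃ y = e := by
  have hx : ∃ x : Fin 3 → ℂ, x ⬝ᵥ x = 1 ∧ x ⬝ᵥ e = 0 := by
    simp only [dotProduct, Fin.sum_univ_three] at he ⊢
    have key : ∀ u v : ℂ, u ^ 2 + v ^ 2 ≠ 0 → ∃ p q : ℂ, p * p + q * q = 1 ∧ p * u + q * v = 0 := by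
      intro u v h
      obtain ⟨σ, hσ⟩ := IsAlgClosed.exists_pow_nat_eq (u ^ 2 + v ^ 2) two_pos
      have hσ0 : σ ≠ 0 := fun h0 => h (by rw [← hσ, h0]; ring)
      refine ⟨v / σ, -u / σ, ?_, ?_⟩
      · field_simp
        linear_combination -hσ
      · field_simp
        ring
    by_cases h2 : e 0 ^ 2 + e 1 ^ 2 = 0
    · by_cases h1 : e 0 ^ 2 + e 2 ^ 2 = 0
      · have h0 : e 1 ^ 2 + e 2 ^ 2 ≠ 0 := fun h0 => by
          have : (2 : ℂ) = 0 := by linear_combination h0 + h1 + h2 - 2 * he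
          exact two_ne_zero this
        obtain ⟨p, q, h3, h4⟩ := key _ _ h0
        exact ⟨![0, p, q], by simpa using h3, by simpa using h4⟩
      · obtain ⟨p, q, h3, h4⟩ := key _ _ h1
        exact ⟨![p, 0, q], by simpa using h3, by simpa using h4⟩
    · obtain ⟨p, q, h3, h4⟩ := key _ _ h2
      exact ⟨![p, q, 0], by simpa using h3, by simpa using h4⟩
  obtain ⟨x, hxx, hxe⟩ := hx
  refine ⟨x, e ⨯₃ x, hxx, ?_, ?_, hxe, ?_, ?_⟩
  · rw [cross_dot_cross, he, hxx, dotProduct_comm e x, hxe]; ring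
  · rw [triple_product_permutation, cross_self, dotProduct_zero]
  · rw [dotProduct_comm, dot_self_cross]
  · simp only [dotProduct, Fin.sum_univ_three] at hxx hxe
    ext i
    simp only [cross_apply', fin3_add_one_add_one, fin3_add_one_add_two, fin3_add_two_add_one,
      fin3_add_two_add_two]
    revert i
    refine forall_fin_three ?_ ?_ ?_ <;>
      simp only [fin3_01, fin3_02, fin3_11, fin3_12, fin3_21, fin3_22]
    · linear_combination e 0 * hxx - x 0 * hxe
    · linear_combination e 1 * hxx - x 1 * hxe
    · linear_combination e 2 * hxx - x 2 * hxe

/-- A frame of solutions of the Poisson equations: a given nonisotropic solution `P` and two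
isotropic solutions orthogonal to it. -/
theorem exists_isotropic_frame (hD : IsOpen D) (hsc : IsSimplyConnected D)
    (hM : DifferentiableOn ℂ M D) {P : ℂ → Fin 3 → ℂ} (hP : IsPoissonSolution a k M D P) {p : ℂ}
    (hp : p ≠ 0) (hPP : ∀ t ∈ D, P t ⬝ᵥ P t = p ^ 2) :
    ∃ G₁ G₂ : ℂ → Fin 3 → ℂ, IsPoissonSolution a k M D G₁ ∧ IsPoissonSolution a k M D G₂ ∧
      (∀ t ∈ D, LinearIndependent ℂ ![P t, G₁ t, G₂ t]) ∧
      (∀ t ∈ D, ∀ i, p ^ 2 * (G₁ t i * G₂ t i) = P t (i + 1) ^ 2 + P t (i + 2) ^ 2) ∧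
      ∀ t ∈ D, ∀ i, ∀ ω : Fin 3 → ℂ,
        p * ((G₁ t (i + 1) * ω (i + 2) - G₁ t (i + 2) * ω (i + 1)) * G₂ t i -
          G₁ t i * (G₂ t (i + 1) * ω (i + 2) - G₂ t (i + 2) * ω (i + 1))) =
        2 * Complex.I * (ω (i + 1) * P t (i + 1) + ω (i + 2) * P t (i + 2)) := by
  obtain ⟨t₀, ht₀⟩ := hsc.nonempty
  have hpc := hsc.isPathConnected.isConnected.isPreconnected
  have he : (p⁻¹ • P t₀) ⬝ᵥ (p⁻¹ • P t₀) = 1 := by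
    rw [smul_dotProduct, dotProduct_smul, hPP t₀ ht₀, smul_eq_mul, smul_eq_mul]
    field_simp
  obtain ⟨x, y, hxx, hyy, hxy, hxe, hye, hcr⟩ := exists_orthonormal_pair he
  obtain ⟨X, hX, rfl⟩ := exists_isPoissonSolution (a := a) (k := k) hD hsc hM ht₀ x
  obtain ⟨Y, hY, rfl⟩ := exists_isPoissonSolution (a := a) (k := k) hD hsc hM ht₀ y
  have hE := hP.smul p⁻¹
  set e : ℂ → Fin 3 → ℂ := fun t => p⁻¹ • P t
  have hPe : ∀ t i, P t i = p * e t i := fun t i => by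
    simp only [e, Pi.smul_apply, smul_eq_mul]
    field_simp
  have dee : ∀ t ∈ D, e t ⬝ᵥ e t = 1 := fun t ht => (hE.dot_eq hD hpc hE ht ht₀).trans he
  have dxx : ∀ t ∈ D, X t ⬝ᵥ X t = 1 := fun t ht => (hX.dot_eq hD hpc hX ht ht₀).trans hxx
  have dyy : ∀ t ∈ D, Y t ⬝ᵥ Y t = 1 := fun t ht => (hY.dot_eq hD hpc hY ht ht₀).trans hyy
  have dxy : ∀ t ∈ D, X t ⬝ᵥ Y t = 0 := fun t ht => (hX.dot_eq hD hpc hY ht ht₀).trans hxy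
  have dxe : ∀ t ∈ D, X t ⬝ᵥ e t = 0 := fun t ht => (hX.dot_eq hD hpc hE ht ht₀).trans hxe
  have dye : ∀ t ∈ D, Y t ⬝ᵥ e t = 0 := fun t ht => (hY.dot_eq hD hpc hE ht ht₀).trans hye
  have dcr : ∀ t ∈ D, X t ⨯₃ Y t = e t := by
    intro t ht
    have h1 := ((hX.cross hY).add (hE.smul (-1))).eq_zero hD hsc hM ht₀
      (by simp only [hcr, e]; module) ht
    rw [neg_one_smul, ← sub_eq_add_neg] at h1
    exact sub_eq_zero.1 h1
  refine ⟨fun t => X t + Complex.I • Y t, fun t => X t + (-Complex.I) • Y t, hX.add (hY.smul _),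
    hX.add (hY.smul _), fun t ht => ?_, fun t ht i => ?_, fun t ht i ω => ?_⟩
  · rw [Fintype.linearIndependent_iff]
    intro g hg
    simp only [Fin.sum_univ_three, Matrix.cons_val_zero, Matrix.cons_val_one,
      Matrix.cons_val_two, Matrix.head_cons, Matrix.tail_cons] at hg
    have hPe' : P t = p • e t := funext (hPe t)
    rw [hPe'] at hg
    have dyx := (dotProduct_comm (Y t) (X t)).trans (dxy t ht)
    have dex := (dotProduct_comm (e t) (X t)).trans (dxe t ht)
    have dey := (dotProduct_comm (e t) (Y t)).trans (dye t ht)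
    have h1 := congrArg (· ⬝ᵥ e t) hg
    have h2 := congrArg (· ⬝ᵥ X t) hg
    have h3 := congrArg (· ⬝ᵥ Y t) hg
    simp only [add_dotProduct, smul_dotProduct, dee t ht, dxe t ht, dye t ht, dxx t ht, dyy t ht,
      dxy t ht, dyx, dex, dey, zero_dotProduct, smul_eq_mul, mul_zero, mul_one, add_zero,
      zero_add] at h1 h2 h3
    have h4 : g 1 = g 2 := by
      have : Complex.I * (g 1 - g 2) = 0 := by linear_combination h3
      exact sub_eq_zero.1 ((mul_eq_zero.1 this).resolve_left Complex.I_ne_zero)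
    have h5 : g 2 = 0 := by linear_combination (h2 - h4) / 2
    exact forall_fin_three ((mul_eq_zero.1 h1).resolve_right hp) (h4.trans h5) h5
  -- The rows of `B` are orthonormal, hence so are its columns: `e_i ^ 2 + X_i ^ 2 + Y_i ^ 2 = 1`.
  · let B : Matrix (Fin 3) (Fin 3) ℂ := Matrix.of ![e t, X t, Y t]
    have hB : B * Bᵀ = 1 := by
      ext i j
      rw [Matrix.mul_apply_eq_vecMul, Matrix.vecMul]
      have dyx := (dotProduct_comm (Y t) (X t)).trans (dxy t ht)
      have dex := (dotProduct_comm (e t) (X t)).trans (dxe t ht)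
      have dey := (dotProduct_comm (e t) (Y t)).trans (dye t ht)
      revert i j
      refine forall_fin_three ?_ ?_ ?_ <;> refine forall_fin_three ?_ ?_ ?_
      · exact dee t ht
      · exact dex
      · exact dey
      · exact dxe t ht
      · exact dxx t ht
      · exact dxy t ht
      · exact dye t ht
      · exact dyx
      · exact dyy t ht
    have hBT : Bᵀ * B = 1 := mul_eq_one_comm.1 hB
    have hB' := congrFun (congrFun hBT i) i
    rw [Matrix.mul_apply, Fin.sum_univ_three, Matrix.one_apply_eq] at hB'
    have hB'' : e t i * e t i + X t i * X t i + Y t i * Y t i = 1 := hB'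
    have h1 := dee t ht
    rw [dotProduct, sum_fin_three_cyclic _ i] at h1
    simp only [hPe, Pi.add_apply, Pi.smul_apply, smul_eq_mul]
    linear_combination p ^ 2 * (hB'' - h1) - p ^ 2 * Y t i ^ 2 * Complex.I_sq
  · have h1 := congrFun (dcr t ht) (i + 1)
    have h2 := congrFun (dcr t ht) (i + 2)
    rw [cross_apply'] at h1 h2
    simp only [fin3_add_one_add_one, fin3_add_one_add_two, fin3_add_two_add_one,
      fin3_add_two_add_two] at h1 h2
    simp only [hPe, Pi.add_apply, Pi.smul_apply, smul_eq_mul]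
    linear_combination 2 * Complex.I * p * (ω (i + 1) * h1 + ω (i + 2) * h2)

end

/-! ### The solution `P` -/

section
variable {a : Fin 3 → ℂ} {c m : ℂ} {k s : ℕ} {T : Fin 3 → ℂ} {M : ℂ → Fin 3 → ℂ} {D : Set ℂ}

theorem isPoissonSolution_vecP (ha : Function.Injective a) (hs : 1 ≤ s) (hk : k = 2 * s + 1)
    (hTker : matA a ((k : ℂ) • a) k *ᵥ T = 0) (hM : IsEulerSolution a D M) :
    IsPoissonSolution a k M D (fun t => vecP a k s T (M t)) := by
  rw [isPoissonSolution_iff]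
  intro t ht i
  have hMd : ∀ i, HasDerivAt (fun t => M t i) (diffs a i * (M t (i + 1) * M t (i + 2))) t := by
    intro i
    convert! (hasDerivAt_pi.1 (hM t ht)) i using 1
    rw [cross_apply', Pi.mul_apply, Pi.mul_apply, diffs]
    ring
  have hK : ∀ i, HasDerivAt (fun t => (M t ^ 2) i)
      (2 * (M t 0 * M t 1 * M t 2) * diffs a i) t := by
    intro i
    convert! (hMd i).pow 2 using 1
    have h := prod_fin_three_cyclic (M t) i
    rw [Fin.prod_univ_three] at h
    rw [h]
    push_cast
    ring
  obtain ⟨h, h1, h2⟩ := exists_hasDerivAt_vecH ha hs hk hTker hK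
  simp only [vecP_apply]
  convert! (hMd i).mul (h1 i) using 1
  have h3 := prod_fin_three_cyclic (M t) i
  rw [Fin.prod_univ_three] at h3
  have h4 := h2 i
  rw [Pi.pow_apply] at h4
  rw [h3]
  linear_combination -(M t (i + 1) * M t (i + 2)) * h4

lemma vecP_dot_self (ha : Function.Injective a) (hc : ∀ i, c ≠ a i) (hs : 1 ≤ s)
    (hk : k = 2 * s + 1) (hTker : matA a ((k : ℂ) • a) k *ᵥ T = 0) (hm : m ≠ 0) {v : Fin 3 → ℂ}
    (h1 : v ⬝ᵥ v = m ^ 2) (h2 : v ⬝ᵥ (a * v) = c * m ^ 2) :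
    vecP a k s T v ⬝ᵥ vecP a k s T v = (m ^ 2) ^ k * sqConst a c k s T := by
  rw [← sqH_of_sums (K := v ^ 2) ha hc hs hk hTker (pow_ne_zero 2 hm)]
  · simp only [dotProduct, vecP_apply, sqH, Pi.pow_apply]
    exact Finset.sum_congr rfl fun i _ => by ring
  · rw [← h1, dotProduct]
    exact Finset.sum_congr rfl fun i _ => by rw [Pi.pow_apply]; ring
  · rw [← h2, dotProduct]
    exact Finset.sum_congr rfl fun i _ => by rw [Pi.pow_apply, Pi.mul_apply]; ring

lemma vecH_sq_of_param {v : Fin 3 → ℂ} {x : ℂ}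
    (h : ∀ i, v i ^ 2 = m ^ 2 * kap a c i * ((x - a i) / (x - c))) (i : Fin 3) :
    vecH a k s T (v ^ 2) s i = (m ^ 2) ^ s * vecH a k s T (lineK a c x) s i := by
  have : v ^ 2 = m ^ 2 • lineK a c x := by
    ext i
    rw [Pi.pow_apply, h, Pi.smul_apply, smul_eq_mul, lineK, mul_assoc]
  rw [this, vecH_smul, Pi.smul_apply, smul_eq_mul]

lemma vecP_sq_of_param {v : Fin 3 → ℂ} {x : ℂ} (hk : k = 2 * s + 1)
    (h : ∀ i, v i ^ 2 = m ^ 2 * kap a c i * ((x - a i) / (x - c))) (i : Fin 3) :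
    vecP a k s T v i ^ 2 =
      (m ^ 2) ^ k * (lineK a c x i * vecH a k s T (lineK a c x) s i ^ 2) := by
  rw [vecP_apply, mul_pow, h, vecH_sq_of_param h, mul_assoc (m ^ 2), ← lineK, hk]
  ring

lemma mul_vecP_of_param {v : Fin 3 → ℂ} {x : ℂ}
    (h : ∀ i, v i ^ 2 = m ^ 2 * kap a c i * ((x - a i) / (x - c))) (i : Fin 3) :
    a i * v i * vecP a k s T v i =
      (m ^ 2) ^ (s + 1) * (a i * lineK a c x i * vecH a k s T (lineK a c x) s i) := by
  have h' := h i
  rw [mul_assoc (m ^ 2), ← lineK] at h'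
  rw [vecP_apply, vecH_sq_of_param h]
  linear_combination a i * ((m ^ 2) ^ s * vecH a k s T (lineK a c x) s i) * h'

/-- The relation between `Q` and `P_β² + P_γ²`. -/
lemma polyQ_eval_of_param (ha : Function.Injective a) (hc : ∀ i, c ≠ a i) (hk : k = 2 * s + 1)
    (hm : m ≠ 0) {v : Fin 3 → ℂ} {x : ℂ} (hx : x ≠ c)
    (h : ∀ i, v i ^ 2 = m ^ 2 * kap a c i * ((x - a i) / (x - c))) (α : Fin 3) :
    (polyQ a c k s T α).eval x = coefQ a c α / (m ^ 2) ^ k *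
      (vecP a k s T v (α + 1) ^ 2 + vecP a k s T v (α + 2) ^ 2) * (x - c) ^ k := by
  rw [polyQ_eval_of_ne ha hc hk α hx, vecP_sq_of_param hk h, vecP_sq_of_param hk h]
  field_simp

end

/-! ### Branches of the logarithm -/

/-- A continuous logarithm is differentiable: near `t` it differs from `L t` by less than `π`, so it
equals `L t` plus the principal logarithm of `f z / f t`. -/
lemma exists_log_branch {V : Set ℂ} (hV : IsOpen V) (hsc : IsSimplyConnected V) {f f' : ℂ → ℂ}
    (hf : ∀ t ∈ V, HasDerivAt f (f' t) t) (hf0 : ∀ t ∈ V, f t ≠ 0) :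
    ∃ L : ℂ → ℂ, ∀ t ∈ V, Complex.exp (L t) = f t ∧ HasDerivAt L (f' t / f t) t := by
  obtain ⟨L, hL, hexp⟩ := Complex.exists_continuousOn_eqOn_exp_comp hsc hV (g := f)
    (fun t ht => (hf t ht).continuousAt.continuousWithinAt)
    (by rintro ⟨t, ht, h0⟩; exact hf0 t ht h0)
  refine ⟨L, fun t ht => ⟨hexp ht, ?_⟩⟩
  have hc : ContinuousAt L t := hL.continuousAt (hV.mem_nhds ht)
  have hloc : L =ᶠ[𝓝 t] fun z => L t + Complex.log (f z / f t) := by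
    have h1 : ∀ᶠ z in 𝓝 t, ‖L z - L t‖ < Real.pi := by
      have : Tendsto (fun z => ‖L z - L t‖) (𝓝 t) (𝓝 ‖L t - L t‖) :=
        ((hc.sub continuousAt_const).norm).tendsto
      rw [sub_self, norm_zero] at this
      exact this.eventually_lt_const Real.pi_pos
    filter_upwards [h1, hV.mem_nhds ht] with z hz hzV
    have h2 : Complex.exp (L z - L t) = f z / f t := by
      rw [Complex.exp_sub]
      exact congrArg₂ _ (hexp hzV) (hexp ht)
    have h3 := abs_lt.1 ((Complex.abs_im_le_norm _).trans_lt hz)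
    rw [← h2, Complex.log_exp h3.1 h3.2.le, add_sub_cancel]
  have hone : f t / f t = 1 := div_self (hf0 t ht)
  have h4 : HasDerivAt (fun z => L t + Complex.log (f z / f t)) (f' t / f t / (f t / f t)) t :=
    (((hf t ht).div_const (f t)).clog (by rw [hone]; exact Complex.one_mem_slitPlane)).const_add _
  rw [hone, div_one] at h4
  exact h4.congr_of_eventuallyEq hloc

/-- The solutions `G₁`, `G₂` in terms of `Q` and `∫ W`. -/
theorem exists_branches {a : Fin 3 → ℂ} (ha : Function.Injective a) {c : ℂ} (hc : ∀ i, c ≠ a i)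
    {k s : ℕ} (hk : k = 2 * s + 1) {T : Fin 3 → ℂ} {m w : ℂ} (hm : m ≠ 0) (hw : w ≠ 0)
    {M G₁ G₂ : ℂ → Fin 3 → ℂ} {V : Set ℂ} (hV : IsOpen V) (hsc : IsSimplyConnected V)
    (hG₁ : IsPoissonSolution a k M V G₁) (hG₂ : IsPoissonSolution a k M V G₂)
    (hprod : ∀ t ∈ V, ∀ i, (w * m ^ k) ^ 2 * (G₁ t i * G₂ t i) =
      vecP a k s T (M t) (i + 1) ^ 2 + vecP a k s T (M t) (i + 2) ^ 2)
    (hwr : ∀ t ∈ V, ∀ i, ∀ ω : Fin 3 → ℂ,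
      w * m ^ k * ((G₁ t (i + 1) * ω (i + 2) - G₁ t (i + 2) * ω (i + 1)) * G₂ t i -
        G₁ t i * (G₂ t (i + 1) * ω (i + 2) - G₂ t (i + 2) * ω (i + 1))) =
      2 * Complex.I * (ω (i + 1) * vecP a k s T (M t) (i + 1) +
        ω (i + 2) * vecP a k s T (M t) (i + 2)))
    {lam mu : ℂ → ℂ} (hpar : IsCurveParam a c m M V lam mu) (α : Fin 3)
    (hQ : ∀ t ∈ V, (polyQ a c k s T α).eval (lam t) ≠ 0) :
    ∃ (R I : ℂ → ℂ) (c₁ c₂ : ℂ), c₁ ≠ 0 ∧ c₂ ≠ 0 ∧ ContinuousOn R V ∧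
      (∀ t ∈ V, R t ^ 2 = (polyQ a c k s T α).eval (lam t) / (lam t - c) ^ k) ∧
      DifferentiableOn ℂ I V ∧
      (∀ t ∈ V, mu t ≠ 0 → HasDerivAt I
        (diffW c s (polyq a c k s T w α) (polyQ a c k s T α) (lam t) (mu t) * deriv lam t) t) ∧
      ∀ t ∈ V, G₁ t α = c₁ * R t * Complex.exp (1 / 2 * I t) ∧
        G₂ t α = c₂ * R t * Complex.exp (-(1 / 2) * I t) := by
  rw [isPoissonSolution_iff] at hG₁ hG₂
  have hp : w * m ^ k ≠ 0 := mul_ne_zero hw (pow_ne_zero _ hm)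
  have hCq := coefQ_ne_zero ha hc α
  have hx : ∀ t ∈ V, lam t - c ≠ 0 := fun t ht => sub_ne_zero.2 (hpar.ne_c t ht)
  have hQG : ∀ t ∈ V, (polyQ a c k s T α).eval (lam t) / (lam t - c) ^ k =
      coefQ a c α * w ^ 2 * (G₁ t α * G₂ t α) := by
    intro t ht
    have := hx t ht
    rw [polyQ_eval_of_param ha hc hk hm (hpar.ne_c t ht) (hpar.param t ht), ← hprod t ht]
    field_simp
    ring
  have hne : ∀ t ∈ V, G₁ t α * G₂ t α ≠ 0 := by
    intro t ht h0
    have h1 := hQG t ht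
    rw [h0, mul_zero] at h1
    exact (div_ne_zero (hQ t ht) (pow_ne_zero _ (hx t ht))) h1
  obtain ⟨L₁, hL₁⟩ := exists_log_branch hV hsc (fun t ht => hG₁ t ht α)
    (fun t ht => left_ne_zero_of_mul (hne t ht))
  obtain ⟨L₂, hL₂⟩ := exists_log_branch hV hsc (fun t ht => hG₂ t ht α)
    (fun t ht => right_ne_zero_of_mul (hne t ht))
  -- This constant is the ratio of `Q / (λ - c) ^ k` to `G¹_α G²_α`, so `u exp ((L₁ + L₂) / 2)` is a
  -- branch of the square root and `L₁ - L₂` a branch of `∫ W`.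
  obtain ⟨u, hu⟩ := IsAlgClosed.exists_pow_nat_eq (coefQ a c α * w ^ 2) two_pos
  have hu0 : u ≠ 0 := by
    rintro rfl
    exact mul_ne_zero hCq (pow_ne_zero 2 hw) (by rw [← hu]; ring)
  have hId : ∀ t ∈ V, HasDerivAt (fun t => L₁ t - L₂ t) _ t := fun t ht =>
    (hL₁ t ht).2.fun_sub (hL₂ t ht).2
  refine ⟨fun t => u * Complex.exp ((L₁ t + L₂ t) / 2), fun t => L₁ t - L₂ t, u⁻¹, u⁻¹,
    inv_ne_zero hu0, inv_ne_zero hu0, ?_, fun t ht => ?_,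
    fun t ht => (hId t ht).differentiableAt.differentiableWithinAt, fun t ht hmu => ?_,
    fun t ht => ⟨?_, ?_⟩⟩
  · exact fun t ht => (continuousAt_const.mul (Complex.continuous_exp.continuousAt.comp
      (((hL₁ t ht).2.continuousAt.add (hL₂ t ht).2.continuousAt).div_const 2))).continuousWithinAt
  · rw [hQG t ht, mul_pow, hu, ← Complex.exp_nat_mul, Nat.cast_two,
      mul_div_cancel₀ _ (two_ne_zero (α := ℂ)), Complex.exp_add, (hL₁ t ht).1, (hL₂ t ht).1]
  · have h1 := left_ne_zero_of_mul (hne t ht)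
    have h2 := right_ne_zero_of_mul (hne t ht)
    have hxt := hx t ht
    have h3 := hwr t ht α (fun i => a i * M t i)
    have h4 := hprod t ht α
    simp only [mul_vecP_of_param (hpar.param t ht)] at h3
    simp only [vecP_sq_of_param hk (hpar.param t ht)] at h4
    convert! hId t ht using 1
    rw [(hpar.deriv_eq t ht).deriv, diffW,
      polyq_eval_of_ne w α (hpar.ne_c t ht), polyQ_eval_of_ne ha hc hk α (hpar.ne_c t ht)]
    set x := lam t
    generalize vecH a k s T (lineK a c x) s (α + 1) = Hβ at *
    generalize vecH a k s T (lineK a c x) s (α + 2) = Hγ at *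
    generalize lineK a c x (α + 1) = Kβ at *
    generalize lineK a c x (α + 2) = Kγ at *
    have hS : Kβ * Hβ ^ 2 + Kγ * Hγ ^ 2 = w ^ 2 * (G₁ t α * G₂ t α) := by
      have : (m ^ 2) ^ k ≠ 0 := pow_ne_zero _ (pow_ne_zero _ hm)
      refine mul_left_cancel₀ this ?_
      linear_combination -h4
    have hN : w * m ^ k * (G₁ t (α + 1) * (a (α + 2) * M t (α + 2)) * G₂ t α -
        G₁ t (α + 2) * (a (α + 1) * M t (α + 1)) * G₂ t α -
        G₁ t α * (G₂ t (α + 1) * (a (α + 2) * M t (α + 2)) -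
          G₂ t (α + 2) * (a (α + 1) * M t (α + 1)))) =
        2 * Complex.I * (m ^ k * m) *
          (a (α + 1) * Kβ * Hβ + a (α + 2) * Kγ * Hγ) := by
      have e : (m ^ 2) ^ (s + 1) = m ^ k * m := by rw [hk]; ring
      rw [e] at h3
      linear_combination h3
    -- The Wronskian times `w` is `2 i m` times the bracket in `polyq`; the factor `2 m` is that of
    -- `λ' = 2 m μ`, whose `μ` cancels the one in `W`.
    have hN' := mul_left_cancel₀ (pow_ne_zero k hm) (a := m ^ k)
      (b := w * (G₁ t (α + 1) * (a (α + 2) * M t (α + 2)) * G₂ t α -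
        G₁ t (α + 2) * (a (α + 1) * M t (α + 1)) * G₂ t α -
        G₁ t α * (G₂ t (α + 1) * (a (α + 2) * M t (α + 2)) -
          G₂ t (α + 2) * (a (α + 1) * M t (α + 1)))))
      (c := 2 * Complex.I * m * (a (α + 1) * Kβ * Hβ + a (α + 2) * Kγ * Hγ))
      (by linear_combination hN)
    rw [hS, div_sub_div _ _ h1 h2]
    have hpow : (x - c) ^ k = (x - c) ^ (s + 1) * (x - c) ^ s := by
      rw [hk]; ring
    rw [hpow, div_mul_eq_mul_div, div_eq_div_iff (by positivity) (hne t ht)]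
    linear_combination (-(k : ℂ) * w * coefQ a c α * (x - c) ^ (s + 1) * (x - c) ^ s * mu t *
      (G₁ t α * G₂ t α)) * hN'
  · rw [mul_assoc, mul_assoc, ← Complex.exp_add, inv_mul_cancel_left₀ hu0, ← (hL₁ t ht).1]
    congr 1
    ring
  · rw [mul_assoc, mul_assoc, ← Complex.exp_add, inv_mul_cancel_left₀ hu0, ← (hL₂ t ht).1]
    congr 1
    ring

end EulerPoisson

end

/-! ### The theorem. -/

theorem mainTheorem2 (k s : ℕ) (hs : 1 ≤ s) (hk : k = 2 * s + 1)
    (a : Fin 3 → ℂ) (ha : Function.Injective a) (c : ℂ) (hc : ∀ i, c ≠ a i)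
    (T : Fin 3 → ℂ) (hT : T ≠ 0) (hTker : matA a ((k : ℂ) • a) k *ᵥ T = 0) :
    ∃ Δ : ℂ, polySq a c k s T = C Δ * (X - C c) ^ k ∧
    -- for real motions `Δ ≠ 0`
    (∀ (a' : Fin 3 → ℝ) (c' : ℝ), (∀ i, a i = a' i) → c = c' →
      (∃ i, a' i < c') → (∃ i, c' < a' i) → Δ ≠ 0) ∧
    (∀ α, (polyQ a c k s T α).eval c ≠ 0) ∧
    ∃ q : Fin 3 → ℂ[X], (∀ α, (q α).natDegree ≤ s + 1) ∧
    -- part 1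
    (Δ ≠ 0 → ∀ m : ℂ, m ≠ 0 → ∃ κ : Fin 3 → ℂ, (∀ α, κ α ≠ 0) ∧
      ∀ (D : Set ℂ) (M : ℂ → Fin 3 → ℂ), IsOpen D → IsSimplyConnected D →
        IsEulerSolution a D M →
        (∀ t ∈ D, M t ⬝ᵥ M t = m ^ 2) → (∀ t ∈ D, M t ⬝ᵥ (a * M t) = c * m ^ 2) →
        IsPoissonSolution a k M D (fun t => vecP a k s T (M t)) ∧
        ∃ G₁ G₂ : ℂ → Fin 3 → ℂ,
          IsPoissonSolution a k M D G₁ ∧ IsPoissonSolution a k M D G₂ ∧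
          (∀ t ∈ D, LinearIndependent ℂ ![vecP a k s T (M t), G₁ t, G₂ t]) ∧
          ∀ (V : Set ℂ) (lam mu : ℂ → ℂ), V ⊆ D → IsOpen V → IsCurveParam a c m M V lam mu →
            (∀ α, ∀ t ∈ V, (polyQ a c k s T α).eval (lam t) =
              κ α * (vecP a k s T (M t) (α + 1) ^ 2 + vecP a k s T (M t) (α + 2) ^ 2) *
                (lam t - c) ^ k) ∧
            ∀ α, IsSimplyConnected V → (∀ t ∈ V, (polyQ a c k s T α).eval (lam t) ≠ 0) →
              ∃ (R I : ℂ → ℂ) (c₁ c₂ : ℂ), c₁ ≠ 0 ∧ c₂ ≠ 0 ∧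
                -- `R` is a branch of `√Q / √((λ - c)^k)` along `V`
                ContinuousOn R V ∧
                (∀ t ∈ V, R t ^ 2 = (polyQ a c k s T α).eval (lam t) / (lam t - c) ^ k) ∧
                -- `I` is a branch of `∫ W` along `V`
                DifferentiableOn ℂ I V ∧
                (∀ t ∈ V, mu t ≠ 0 → HasDerivAt I
                  (diffW c s (q α) (polyQ a c k s T α) (lam t) (mu t) * deriv lam t) t) ∧
                ∀ t ∈ V, G₁ t α = c₁ * R t * Complex.exp (1 / 2 * I t) ∧
                  G₂ t α = c₂ * R t * Complex.exp (-(1 / 2) * I t)) ∧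
    -- part 2
    (∀ (α : Fin 3) (r₀ : ℂ) (r : Fin k → ℂ), r₀ ≠ 0 → Function.Injective r →
      polyQ a c k s T α = C r₀ * ∏ i, (X - C (r i)) → (∀ i j, r i ≠ a j) →
      ∃ ν : Fin k → ℂ, (∀ i, ν i ^ 2 = (polyU a c).eval (r i)) ∧ (∀ i, ν i ≠ 0) ∧
        (∀ i, FinitePart a c (diffW c s (q α) (polyQ a c k s T α)) (r i) (ν i) 1 ∧
          FinitePart a c (diffW c s (q α) (polyQ a c k s T α)) (r i) (-ν i) (-1)) ∧
        (∀ x₀ y₀ : ℂ, y₀ ^ 2 = (polyU a c).eval x₀ → (∀ i, x₀ ≠ r i) →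
          FinitePart a c (diffW c s (q α) (polyQ a c k s T α)) x₀ y₀ 0) ∧
        (∀ η₀ : ℂ, η₀ ^ 2 = (polyV a c).eval 0 →
          InfinitePart a c (diffW c s (q α) (polyQ a c k s T α)) η₀ 0) ∧
        ∀ q' : ℂ[X], q'.natDegree ≤ s + 1 →
          (∀ i, FinitePart a c (diffW c s q' (polyQ a c k s T α)) (r i) (ν i) 1 ∧
            FinitePart a c (diffW c s q' (polyQ a c k s T α)) (r i) (-ν i) (-1)) →
          q' = q α) := by
  -- One square root of `Δ` is fixed for all `α`; it enters `q`, and `w m ^ k` is the length by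
  -- which `P` is normalized.
  obtain ⟨w, hw⟩ := IsAlgClosed.exists_pow_nat_eq (sqConst a c k s T) two_pos
  refine ⟨sqConst a c k s T, polySq_eq ha hs hk hTker, fun a' c' haa hcc h1 h2 =>
    sqConst_ne_zero ha hc hs hk hT hTker haa hcc h1 h2,
    polyQ_eval_c_ne_zero ha hc hk hT hTker, polyq a c k s T w, natDegree_polyq_le w,
    fun hΔ m hm => ⟨fun α => coefQ a c α / (m ^ 2) ^ k, fun α =>
      div_ne_zero (coefQ_ne_zero ha hc α) (pow_ne_zero _ (pow_ne_zero _ hm)),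
      fun D M hD hsc hM h1 h2 => ?_⟩, fun α r₀ r hr₀ hr hQ hra => ?_⟩
  · have hP := isPoissonSolution_vecP ha hs hk hTker hM
    have hw0 : w ≠ 0 := by
      rintro rfl
      exact hΔ (by rw [← hw]; ring)
    have hp : w * m ^ k ≠ 0 := mul_ne_zero hw0 (pow_ne_zero _ hm)
    obtain ⟨G₁, G₂, hG₁, hG₂, hlin, hprod, hwr⟩ := exists_isotropic_frame hD hsc
      (fun t ht => (hM t ht).differentiableAt.differentiableWithinAt) hP hp (fun t ht => by
        rw [vecP_dot_self ha hc hs hk hTker hm (h1 t ht) (h2 t ht), ← hw]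
        ring)
    refine ⟨hP, G₁, G₂, hG₁, hG₂, hlin, fun V lam mu hVD hV hpar => ⟨fun α t ht =>
      polyQ_eval_of_param ha hc hk hm (hpar.ne_c t ht) (hpar.param t ht) α,
      fun α hscV hQ => ?_⟩⟩
    exact exists_branches ha hc hk hm hw0 hV hscV (fun t ht => hG₁ t (hVD ht))
      (fun t ht => hG₂ t (hVD ht)) (fun t ht => hprod t (hVD ht)) (fun t ht => hwr t (hVD ht))
      hpar α hQ
  · exact residues_diffW ha hc hs hk (natDegree_polyq_le w α)
      (polyQ_eval_c_ne_zero ha hc hk hT hTker α)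
      (fun x hx hx0 => sq_residue ha hc hs hk hTker α hw hx hx0) hr₀ hr hQ hra
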